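/- **Setting.** A procedure is a flow graph with an entry and an exit node, in which each node $i$ carries one statement: $\alpha_x=\alpha_y$, $\alpha_x=\mathit{new}$, $\alpha_x=\mathit{null}$, a call $\alpha_x=f(\alpha_{y_1},\alpha_{y_2},\dots)$, a use statement ($\alpha_y.d,\dots$ with non-reference members $d$), $\mathit{return}\ \alpha_z$, or a statement that does not refer to the heap. $In_i$ and $Out_i$ are the program points just before and after $i$. An access path $\rho=x\to f_1\to\dots\to f_k$ corresponds to the access expression $\alpha=x.f_1\cdots f_k$; it is simple if $k=0$, otherwise $Base(\rho)=x\to f_1\to\dots\to f_{k-1}$. $\rho\to *$ is the set of all $\rho\to\sigma$ ($\sigma$ a possibly empty sequence of fields). $Pre(\rho)$ is the set of nonempty prefixes of $\rho$, $PP(\rho)$ the set of the proper ones. A link of the memory graph is the link of a root variable or of a field of an object; $\rho$ denotes the last link of the path. Execution along a control flow path ignores conditions; dereferencing null raises an exception. Locals are null at the entry. A callee is arbitrary, but it can read and change only globals and objects reachable from globals and arguments, create objects, and return (or store) references to these; its result depends only on this part of the memory, on the arguments and on the position of the call in the execution. Write $Pass_s$ for the set of paths rooted at globals or in some $\rho_{y_j}\to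 *$, and $Exp_s$ for $Pass_s$ without those $\rho_{y_j}$ that are not rooted at globals and do not properly extend another argument path. **Analyses.** Each is any solution of the following data flow inequations; this includes the extremal solutions and safe coarser ones. *May-aliases* (flow-sensitive, without kills): relations $A_p$, reflexive and closed under appending the same field to both paths. The link aliases of $\rho$ are $LnA_p(\rho)=\{\rho\}\cup\{\tau'\to f\mid \rho=\tau\to f,\ (\tau,\tau')\in A_p\}$. $A$ at the entry contains all pairs of paths rooted at globals or parameters; $A_{Out_i}\subseteq A_{In_j}$ for each edge $i\to j$. For the statement $s$ at $i$: if $(\rho_1',\rho_2')\in A_{In_i}$ and, for each $k$, $\rho_k=\rho_k'$, or $s$ is $\alpha_x=\alpha_y$ and $\rho_k=\tau\to\sigma$, $\rho_k'=\rho_y\to\sigma$ with $\tau\in LnA_{In_i}(\rho_x)$, then $(\rho_1,\rho_2)\in A_{Out_i}$; if $s$ is $\alpha_x=\mathit{new}$, then all pairs of $LnA_{In_i}(\rho_x)$ are in $A_{Out_i}$; if $s$ is a call, then $A_{Out_i}$ contains all pairs of paths that each have a prefix which is in $LnA_{In_i}(\rho_x)$ or is related by $A_{In_i}$ to a path of $Pass_s$.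 *Liveness*: sets $Live(p)$, closed under $LnA_p$, with $Live(Out_{exit})$ containing all paths rooted at globals or parameters, $Live(In_j)\subseteq Live(Out_i)$ for each edge $i\to j$, and $Live(In_i)\supseteq (X\setminus\rho_x\to *)\cup Uses_s\cup\{\rho_y\to\sigma\mid \rho_x\to\sigma\in X\}$, where $X=Live(Out_i)$, $\rho_x$ is the path assigned by $s$ (if any), and the last set occurs only for $\alpha_x=\alpha_y$. Here $Uses_s$, the paths whose links are used by $s$, is $PP(\rho_x)\cup PP(\rho_y)$ for $\alpha_x=\alpha_y$; $PP(\rho_x)$ for $\alpha_x=\mathit{new}$ and $\alpha_x=\mathit{null}$; $PP(\rho_x)\cup\bigcup_j Pre(\rho_{y_j})\cup Pass_s$ for a call; $\bigcup Pre(\rho_y)$ for a use statement; $Pre(\rho_z)\cup\rho_z\to *$ for a return; and $\emptyset$ otherwise. (A reference that is merely copied is used where the copy is used.) *Availability and anticipability*: let $Kill_s$ at $p$ be the set of paths with a prefix in $LnA_p(\rho_x)$ or, if $s$ is a call, in $LnA_p(\theta)$ for some $\theta\in Exp_s$. $Av(In_{entry})=\emptyset$, $Av(In_j)\subseteq Av(Out_i)$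 for each edge $i\to j$, and, with $X=Av(In_i)$ and $Kill_s$ at $In_i$, $Av(Out_i)\subseteq((X\cup D_s)\setminus Kill_s)\cup G_s\cup T_s$, where $D_s$ is $PP(\rho_x)\cup PP(\rho_y)$ for $\alpha_x=\alpha_y$, $PP(\rho_x)$ for $\mathit{new}$, $\mathit{null}$ and calls, $\bigcup Pre(\rho_y)$ for a use statement, $PP(\rho_z)$ for a return; $G_s=\{\rho_x\}$ for $\mathit{new}$; $T_s=\{\rho_x\to\sigma\mid\rho_y\to\sigma\in X\}$ for $\alpha_x=\alpha_y$; and these sets are empty otherwise. $An(Out_{exit})=\emptyset$, $An(Out_i)\subseteq An(In_j)$ for each edge $i\to j$, and, with $X=An(Out_i)$ and $Kill_s$ at $Out_i$, $An(In_i)\subseteq(X\setminus Kill_s)\cup D'_s\cup T'_s$, where $D'_s$ is $D_s$ together with $\bigcup_j PP(\rho_{y_j})$ for calls, and $T'_s=\{\rho_y\to\sigma\mid\rho_x\to\sigma\in X\}$ for $\alpha_x=\alpha_y$ and empty otherwise. **Algorithm.** $Nullable(\rho,p)$ holds if $\rho\notin Live(p)$ and ($\rho$ is simple or $Base(\rho)\in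 Av(p)\cup An(p)$). At a point $p$ the algorithm inserts assignments $\alpha=\mathit{null}$, in any order, only for paths $\rho$ with $Nullify(\rho,p)$: $Nullable(\rho,p)$ holds, $PP(\rho)\subseteq Live(p)$, and moreover, if $p=Out_i$: $Nullable(\rho,In_i)$ fails or some prefix of $\rho$ is in $LnA_{In_i}(\rho_x)$, where $\rho_x$ is assigned at $i$; if $p=In_i$: $\rho$ is not the path assigned at $i$, and $Nullable(\rho,Out_j)$ fails for some predecessor $j$ of $i$. **Theorem (Safety of null insertion).** Consider a control flow path from the entry to the exit and an initial memory such that the original program, executed along this path, raises no exception and the heap reachable from the variables of the procedure has no cycles at any point of this execution. Execute the modified program, i.e. the program with the inserted assignments, along the same path. Then every inserted assignment $\alpha^b=\mathit{null}$ on the path is reached, and 1. executing it raises no dereferencing exception; 2. every later step, be it an original statement, an inserted null assignment or the final return of control to the caller, is reached, and no link used in it has been nullified by $\alpha^b=\mathit{null}$, i.e. no such link then holds the null reference stored by this execution of $\alpha^b=\mathit{null}$, be it stored there directly or copied there by later assignments. The links used by an original statement $s$ are those denoted by the paths in $Uses_s$, those used by an inserted $\alpha^a=\mathit{null}$ are those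 denoted by $PP(\rho^a)$, and at the final return of control every link reachable from a global or a parameter counts as used. -/

import Mathlib

namespace HRA

/-! ### Access paths -/

/-- An access path `x → f₁ → … → f_k`: a root variable followed by field names. -/
@[ext] structure AP (V F : Type*) where
  root : V
  fields : List F

namespace AP
variable {V F : Type*}

/-- `ρ → σ`. -/
def ext' (ρ : AP V F) (σ : List F) : AP V F := ⟨ρ.root, ρ.fields ++ σ⟩

/-- A simple access path consists of a root variable only. -/
def Simple (ρ : AP V F) : Prop := ρ.fields = []

/-- `Base ρ` (meaningful for paths that are not simple): `ρ` without its last field name. -/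
def base (ρ : AP V F) : AP V F := ⟨ρ.root, ρ.fields.dropLast⟩

/-- `ρ → *`: all paths that have `ρ` as a prefix. -/
def star (ρ : AP V F) : Set (AP V F) := {ρ' | ∃ σ, ρ' = ρ.ext' σ}

/-- `Prefixes(ρ)`: all nonempty prefixes of `ρ`, including `ρ`. -/
def prefixes (ρ : AP V F) : Set (AP V F) := {τ | ∃ σ, ρ = τ.ext' σ}

/-- The nonempty proper prefixes of `ρ`, that is, `Prefixes(Base(ρ))`. -/
def properPrefixes (ρ : AP V F) : Set (AP V F) := {τ | ∃ σ, σ ≠ [] ∧ ρ = τ.ext' σ}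

end AP

/-! ### Programs -/

/-- The statements. `V`: variables, `F`: fields, `Fn`: names of callees. -/
inductive Stmt (V F Fn : Type*) where
  /-- `α_x = α_y` -/
  | assign (x y : AP V F)
  /-- `α_x = new` -/
  | alloc (x : AP V F)
  /-- `α_x = null` -/
  | null (x : AP V F)
  /-- `α_x = f(α_{y₁}, α_{y₂}, …)` -/
  | call (x : AP V F) (f : Fn) (ys : List (AP V F))
  /-- `use α_{y₁}.d, α_{y₂}.d, …` with non-reference members `d` -/
  | use (ys : List (AP V F))
  /-- `return α_z` -/
  | ret (z : AP V F)
  /-- any statement that does not refer to the heap -/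
  | other

/-- The access path that a statement assigns. -/
def Stmt.lhs {V F Fn : Type*} : Stmt V F Fn → Option (AP V F)
  | .assign x _ => some x
  | .alloc x => some x
  | .null x => some x
  | .call x _ _ => some x
  | _ => none

/-- The flow graph of a procedure: every node `i : N` carries one statement. -/
structure Proc (V F N Fn : Type*) where
  stmt : N → Stmt V F Fn
  edge : N → N → Prop
  entry : N
  exit : N
  globals : Set V
  params : Set V

/-- The program points immediately before (`In i`) and after (`Out i`) a statement. -/
inductive Point (N : Type*) where
  | before (i : N)
  | after (i : N)

section Flow
variable {V F N Fn : Type*}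

/-- All access paths rooted at a global or formal parameter. -/
def Proc.outer (P : Proc V F N Fn) : Set (AP V F) :=
  {ρ | ρ.root ∈ P.globals ∨ ρ.root ∈ P.params}

/-- `Summary({ρ_y} ∪ Globals)`: the access paths that are handed over to a callee. -/
def Proc.passed (P : Proc V F N Fn) (ys : List (AP V F)) : Set (AP V F) :=
  {ρ | ρ.root ∈ P.globals ∨ ∃ y ∈ ys, ρ ∈ y.star}

/-- The access paths whose links a callee may assign: as `Proc.passed`, without the
argument expressions themselves, which are passed by value. -/
def Proc.exposed (P : Proc V F N Fn) (ys : List (AP V F)) : Set (AP V F) :=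
  {ρ | ρ.root ∈ P.globals ∨ ∃ y ∈ ys, y ∈ ρ.properPrefixes}

/-- `LDirect_s`: the access paths whose links are used by `s` itself. A link whose reference
is merely copied by an assignment is used where the copy is used. -/
def Proc.uses (P : Proc V F N Fn) : Stmt V F Fn → Set (AP V F)
  | .assign x y => x.properPrefixes ∪ y.properPrefixes
  | .alloc x => x.properPrefixes
  | .null x => x.properPrefixes
  | .call x _ ys => x.properPrefixes ∪ {ρ | ∃ y ∈ ys, ρ ∈ y.prefixes} ∪ P.passed ys
  | .use ys => {ρ | ∃ y ∈ ys, ρ ∈ y.prefixes}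
  | .ret z => z.prefixes ∪ z.star
  | .other => ∅

/-! ### May-aliasing

`A p ρ ρ'` says that the pair `⟨ρ, ρ'⟩` is in the alias information at the point `p`. -/

/-- The link aliases `LnA(ρ)` of an access path: `ρ` itself, and the paths that end in the
same field name and have aliased bases. -/
def linkAliases (R : AP V F → AP V F → Prop) (ρ : AP V F) : Set (AP V F) :=
  {ρ' | ρ' = ρ ∨ ∃ τ τ' f, R τ τ' ∧ ρ = τ.ext' [f] ∧ ρ' = τ'.ext' [f]}

/-- `Origin R s ρ ρ'`: the object that `ρ` reaches after `s` may be the one that `ρ'` reaches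
before `s`, where `R` is the alias information before `s`. -/
inductive Origin (R : AP V F → AP V F → Prop) (s : Stmt V F Fn) : AP V F → AP V F → Prop
  | same (ρ : AP V F) : Origin R s ρ ρ
  | copy {x y τ : AP V F} (σ : List F) : s = .assign x y → τ ∈ linkAliases R x →
      Origin R s (τ.ext' σ) (y.ext' σ)

/-- The paths that, after a call, may lead through its result, or through a global or an
object that the callee can reach. -/
def Proc.touched (P : Proc V F N Fn) (R : AP V F → AP V F → Prop) (x : AP V F)
    (ys : List (AP V F)) : Set (AP V F) :=
  {ρ | ∃ τ ∈ ρ.prefixes, τ ∈ linkAliases R x ∨ ∃ θ ∈ P.passed ys, R θ τ}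

/-- The alias pairs that hold after `s` if those of `R` hold before it. -/
def Proc.aliasGen (P : Proc V F N Fn) (R : AP V F → AP V F → Prop) (s : Stmt V F Fn)
    (ρ₁ ρ₂ : AP V F) : Prop :=
  (∃ ρ₁' ρ₂', Origin R s ρ₁ ρ₁' ∧ Origin R s ρ₂ ρ₂' ∧ R ρ₁' ρ₂') ∨
  match s with
  | .alloc x => ρ₁ ∈ linkAliases R x ∧ ρ₂ ∈ linkAliases R x
  | .call x _ ys => ρ₁ ∈ P.touched R x ys ∧ ρ₂ ∈ P.touched R x ys
  | _ => False

/-- The flow-sensitive may-alias analysis without kills: `A` is a (not necessarily the least)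
solution of its data flow equations. At the entry nothing is known about how globals and
parameters are aliased. -/
structure IsAliasInfo (P : Proc V F N Fn) (A : Point N → AP V F → AP V F → Prop) : Prop where
  refl : ∀ p ρ, A p ρ ρ
  field : ∀ p ρ ρ' f, A p ρ ρ' → A p (ρ.ext' [f]) (ρ'.ext' [f])
  entry : ∀ ρ ∈ P.outer, ∀ ρ' ∈ P.outer, A (.before P.entry) ρ ρ'
  flow : ∀ i ρ ρ', P.aliasGen (A (.before i)) (P.stmt i) ρ ρ' → A (.after i) ρ ρ'
  merge : ∀ i j, P.edge i j → ∀ ρ ρ', A (.after i) ρ ρ' → A (.before j) ρ ρ'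

/-! ### Liveness -/

/-- `LKill_s` -/
def liveKill (s : Stmt V F Fn) : Set (AP V F) :=
  {ρ | ∃ x, s.lhs = some x ∧ ρ ∈ x.star}

/-- `LTransfer_s(X)` -/
def liveTransfer (s : Stmt V F Fn) (X : Set (AP V F)) : Set (AP V F) :=
  {ρ | ∃ x y σ, s = .assign x y ∧ x.ext' σ ∈ X ∧ ρ = y.ext' σ}

/-- `StatementLiveness_s(X)` -/
def Proc.stmtLive (P : Proc V F N Fn) (s : Stmt V F Fn) (X : Set (AP V F)) : Set (AP V F) :=
  (X \ liveKill s) ∪ P.uses s ∪ liveTransfer s X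

/-- Liveness: `L` is a (not necessarily the least) solution of the backward data flow
equations of liveness, closed under link aliasing at every point. A coarser solution, such
as one represented by summarized access graphs, is allowed. -/
structure IsLiveInfo (P : Proc V F N Fn) (A : Point N → AP V F → AP V F → Prop)
    (L : Point N → Set (AP V F)) : Prop where
  exit : P.outer ⊆ L (.after P.exit)
  merge : ∀ i j, P.edge i j → L (.before j) ⊆ L (.after i)
  flow : ∀ i, P.stmtLive (P.stmt i) (L (.after i)) ⊆ L (.before i)
  closed : ∀ p, ∀ ρ ∈ L p, linkAliases (A p) ρ ⊆ L p

/-! ### Availability and anticipability -/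

/-- `AvKill_s` and `AnKill_s`: every path with a prefix that may be link-aliased, with
respect to `R`, to an access path whose link is assigned by `s` or by the callee in `s`. -/
def Proc.kill (P : Proc V F N Fn) (R : AP V F → AP V F → Prop) (s : Stmt V F Fn) :
    Set (AP V F) :=
  {ρ | ∃ τ ∈ ρ.prefixes,
    (∃ x, s.lhs = some x ∧ τ ∈ linkAliases R x) ∨
    (∃ x f ys, s = .call x f ys ∧ ∃ θ ∈ P.exposed ys, τ ∈ linkAliases R θ)}

/-- The access paths that `s` dereferences, as far as availability takes them into account. -/
def avDeref : Stmt V F Fn → Set (AP V F)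
  | .assign x y => x.properPrefixes ∪ y.properPrefixes
  | .alloc x => x.properPrefixes
  | .null x => x.properPrefixes
  | .call x _ _ => x.properPrefixes
  | .use ys => {ρ | ∃ y ∈ ys, ρ ∈ y.prefixes}
  | .ret z => z.properPrefixes
  | .other => ∅

/-- The access path to which `s` assigns a new object. -/
def avGen : Stmt V F Fn → Set (AP V F)
  | .alloc x => {x}
  | _ => ∅

/-- `AvTransfer_s(X)` -/
def avTransfer (s : Stmt V F Fn) (X : Set (AP V F)) : Set (AP V F) :=
  {ρ | ∃ x y σ, s = .assign x y ∧ y.ext' σ ∈ X ∧ ρ = x.ext' σ}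

/-- `StatementAvail_s(X)`. What `s` dereferences is available after `s` unless `s` itself
kills it (as `x = x.n` kills `x`). -/
def Proc.stmtAvail (P : Proc V F N Fn) (R : AP V F → AP V F → Prop) (s : Stmt V F Fn)
    (X : Set (AP V F)) : Set (AP V F) :=
  ((X ∪ avDeref s) \ P.kill R s) ∪ avGen s ∪ avTransfer s X

/-- Availability: `Av` is a (not necessarily the greatest) solution of the forward data flow
equations. -/
structure IsAvailInfo (P : Proc V F N Fn) (A : Point N → AP V F → AP V F → Prop)
    (Av : Point N → Set (AP V F)) : Prop where
  entry : Av (.before P.entry) = ∅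
  merge : ∀ i j, P.edge i j → Av (.before j) ⊆ Av (.after i)
  flow : ∀ i, Av (.after i) ⊆ P.stmtAvail (A (.before i)) (P.stmt i) (Av (.before i))

/-- `AnDirect_s`: the access paths that `s` dereferences. -/
def anDirect : Stmt V F Fn → Set (AP V F)
  | .assign x y => x.properPrefixes ∪ y.properPrefixes
  | .alloc x => x.properPrefixes
  | .null x => x.properPrefixes
  | .call x _ ys => x.properPrefixes ∪ {ρ | ∃ y ∈ ys, ρ ∈ y.properPrefixes}
  | .use ys => {ρ | ∃ y ∈ ys, ρ ∈ y.prefixes}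
  | .ret z => z.properPrefixes
  | .other => ∅

/-- `AnTransfer_s(X)` -/
def anTransfer (s : Stmt V F Fn) (X : Set (AP V F)) : Set (AP V F) :=
  {ρ | ∃ x y σ, s = .assign x y ∧ x.ext' σ ∈ X ∧ ρ = y.ext' σ}

/-- `StatementAnt_s(X)` -/
def Proc.stmtAnt (P : Proc V F N Fn) (R : AP V F → AP V F → Prop) (s : Stmt V F Fn)
    (X : Set (AP V F)) : Set (AP V F) :=
  (X \ P.kill R s) ∪ anDirect s ∪ anTransfer s X

/-- Anticipability: `An` is a (not necessarily the greatest) solution of the backward data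
flow equations. -/
structure IsAntInfo (P : Proc V F N Fn) (A : Point N → AP V F → AP V F → Prop)
    (An : Point N → Set (AP V F)) : Prop where
  exit : An (.after P.exit) = ∅
  merge : ∀ i j, P.edge i j → An (.after i) ⊆ An (.before j)
  flow : ∀ i, An (.before i) ⊆ P.stmtAnt (A (.after i)) (P.stmt i) (An (.after i))

/-! ### Insertion of null assignments -/

/-- `Nullable(ρ, p)`: `ρ` is not live at `p`, and `Base(ρ)`, if `ρ` is not simple, is available
or anticipable at `p`. -/
def Nullable (L Av An : Point N → Set (AP V F)) (ρ : AP V F) (p : Point N) : Prop :=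
  ρ ∉ L p ∧ (ρ.Simple ∨ ρ.base ∈ Av p ∪ An p)

/-- `Transp(ρ, i)`: no prefix of `ρ` may be link-aliased at `In i` to what `i` assigns. -/
def Proc.Transp (P : Proc V F N Fn) (A : Point N → AP V F → AP V F → Prop) (ρ : AP V F)
    (i : N) : Prop :=
  ∀ x, (P.stmt i).lhs = some x → ∀ τ ∈ ρ.prefixes, τ ∉ linkAliases (A (.before i)) x

/-- `Nullify(ρ, p)`: the criterion by which `α = null` is inserted at `p`. -/
def Proc.Nullify (P : Proc V F N Fn) (A : Point N → AP V F → AP V F → Prop)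
    (L Av An : Point N → Set (AP V F)) (ρ : AP V F) (p : Point N) : Prop :=
  Nullable L Av An ρ p ∧ ρ.properPrefixes ⊆ L p ∧
  match p with
  | .after i => ¬ Nullable L Av An ρ (.before i) ∨ ¬ P.Transp A ρ i
  | .before i => (P.stmt i).lhs ≠ some ρ ∧
      ¬ ∀ j, P.edge j i → Nullable L Av An ρ (.after j)

end Flow

/-! ### Memory graphs -/

/-- A link of a memory graph: the link of a root variable, or of a field of an object. -/
inductive Link (V F : Type*) where
  | var (v : V)
  | field (n : ℕ) (f : F)

/-- A memory graph. The allocated objects are the numbers below `next`; `none` is null. -/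
structure Mem (V F : Type*) where
  var : V → Option ℕ
  field : ℕ → F → Option ℕ
  next : ℕ

namespace Mem
variable {V F : Type*}

/-- `Target(ρ)`; `none` if a reference on the way, or the last one, is null. -/
def target (m : Mem V F) (ρ : AP V F) : Option ℕ :=
  ρ.fields.foldl (fun o f => o.bind fun n => m.field n f) (m.var ρ.root)

/-- The link that `ρ` denotes, i.e. the last link of the path; `none` if following `Base(ρ)`
dereferences null. -/
def link (m : Mem V F) (ρ : AP V F) : Option (Link V F) :=
  match ρ.fields.getLast? with
  | none => some (.var ρ.root)
  | some f => (m.target ρ.base).map fun n => .field n f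

open Classical in
/-- Store the reference `v` in the link `l`. -/
noncomputable def write (m : Mem V F) (l : Link V F) (v : Option ℕ) : Mem V F where
  var := fun x => if l = .var x then v else m.var x
  field := fun n f => if l = .field n f then v else m.field n f
  next := m.next

/-- The links of a path set in a memory graph. -/
def links (m : Mem V F) (X : Set (AP V F)) : Set (Link V F) :=
  {l | ∃ ρ ∈ X, m.link ρ = some l}

/-- The non-null targets of a path set in a memory graph. -/
def objects (m : Mem V F) (X : Set (AP V F)) : Set ℕ :=
  {n | ∃ ρ ∈ X, m.target ρ = some n}

/-- The part of the memory graph that is reachable through the variables is acyclic. -/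
def Acyclic (m : Mem V F) : Prop :=
  ∀ (ρ : AP V F) (σ : List F) (n : ℕ), σ ≠ [] → m.target ρ = some n →
    m.target (ρ.ext' σ) ≠ some n

/-- References point to allocated objects; other objects have no outgoing references. -/
def Valid (m : Mem V F) : Prop :=
  (∀ x n, m.var x = some n → n < m.next) ∧
  (∀ k f n, m.field k f = some n → k < m.next ∧ n < m.next)

end Mem

/-! ### Execution -/

/-- The behaviour of the callees: the result of calling `f` as the `k`-th step of an execution
is a function of the part of the memory graph that is passed to it and of the references that
are its arguments; it consists of a memory graph and a returned reference, or is `none` if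
the callee raises an exception or does not return. -/
abbrev Env (V F Fn : Type*) := ℕ → Fn → Mem V F → List (Option ℕ) → Option (Mem V F × Option ℕ)

section Exec
variable {V F N Fn : Type*}

open Classical in
/-- What a callee gets to see: the globals and the objects in `R`. -/
noncomputable def Proc.view (P : Proc V F N Fn) (m : Mem V F) (R : Set ℕ) : Mem V F where
  var := fun x => if x ∈ P.globals then m.var x else none
  field := fun n f => if n ∈ R then m.field n f else none
  next := m.next

open Classical in
/-- The memory graph after a callee that sees the objects in `R` has turned its part of the
memory graph `m` into `m'`: it can change the globals and the objects in `R`, and create new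
objects. -/
noncomputable def Proc.overlay (P : Proc V F N Fn) (m : Mem V F) (R : Set ℕ) (m' : Mem V F) :
    Mem V F where
  var := fun x => if x ∈ P.globals then m'.var x else m.var x
  field := fun n f => if n ∈ R ∨ m.next ≤ n then m'.field n f else m.field n f
  next := m'.next

/-- A callee can only produce references to the objects it sees and to objects it creates. -/
def Proc.Admissible (P : Proc V F N Fn) (m : Mem V F) (R : Set ℕ) (m' : Mem V F)
    (v : Option ℕ) : Prop :=
  let ok : Option ℕ → Prop := fun o => ∀ n, o = some n → n ∈ R ∨ (m.next ≤ n ∧ n < m'.next)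
  m.next ≤ m'.next ∧ ok v ∧ (∀ x ∈ P.globals, ok (m'.var x)) ∧
  (∀ n f, n ∈ R ∨ m.next ≤ n → ok (m'.field n f)) ∧
  (∀ n f, m'.next ≤ n → m'.field n f = none)

open Classical in
/-- Execution of the statement `s` as the `k`-th step; `none` if an exception is raised (or a
callee does not return). -/
noncomputable def Proc.execStmt (P : Proc V F N Fn) (env : Env V F Fn) (k : ℕ) (m : Mem V F) :
    Stmt V F Fn → Option (Mem V F)
  | .assign x y => (m.link x).bind fun l => (m.link y).map fun _ => m.write l (m.target y)
  | .alloc x => (m.link x).map fun l => { m.write l (some m.next) with next := m.next + 1 }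
  | .null x => (m.link x).map fun l => m.write l none
  | .call x f ys => (m.link x).bind fun l =>
      if ∀ y ∈ ys, m.link y ≠ none then
        let R := m.objects (P.passed ys)
        (env k f (P.view m R) (ys.map m.target)).bind fun r =>
          if P.Admissible m R r.1 r.2 then some ((P.overlay m R r.1).write l r.2) else none
      else none
  | .use ys => if ∀ y ∈ ys, m.target y ≠ none then some m else none
  | .ret z => (m.link z).map fun _ => m
  | .other => some m

/-- A step of an execution: an original statement with its position in the execution path, an
inserted assignment `α = null`, or the return of control to the caller at the exit. -/
inductive Step (V F Fn : Type*) where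
  | orig (k : ℕ) (s : Stmt V F Fn)
  | inserted (ρ : AP V F)
  | finish

/-- Execution of a step; `none` if an exception is raised. -/
noncomputable def Proc.exec (P : Proc V F N Fn) (env : Env V F Fn) (m : Mem V F) :
    Step V F Fn → Option (Mem V F)
  | .orig k s => P.execStmt env k m s
  | .inserted ρ => P.execStmt env 0 m (.null ρ)
  | .finish => some m

/-- Execution of a sequence of steps. -/
noncomputable def Proc.run (P : Proc V F N Fn) (env : Env V F Fn) :
    List (Step V F Fn) → Mem V F → Option (Mem V F)
  | [], m => some m
  | a :: as, m => (P.exec env m a).bind fun m' => P.run env as m'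

/-- The steps along the execution path `π` in the program in which, at each point `p`, null is
assigned to the access paths in the list `ins p`. -/
def Proc.steps (P : Proc V F N Fn) (ins : Point N → List (AP V F)) (π : List N) :
    List (Step V F Fn) :=
  (π.zipIdx.flatMap fun ik =>
    (ins (.before ik.1)).map .inserted ++ [.orig ik.2 (P.stmt ik.1)] ++
      (ins (.after ik.1)).map .inserted) ++ [.finish]

/-- A control flow path from the entry to the exit. -/
def Proc.IsPath (P : Proc V F N Fn) (π : List N) : Prop :=
  π.head? = some P.entry ∧ π.getLast? = some P.exit ∧ π.IsChain P.edge

/-- Initial memory graphs: everything that is neither global nor a parameter is null. -/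
def Proc.IsInitial (P : Proc V F N Fn) (m : Mem V F) : Prop :=
  m.Valid ∧ ∀ x, x ∉ P.globals → x ∉ P.params → m.var x = none

/-- The access paths whose links are used in a step. After the exit, everything that is
reachable from the globals and the parameters counts as used. -/
def Proc.stepUses (P : Proc V F N Fn) : Step V F Fn → Set (AP V F)
  | .orig _ s => P.uses s
  | .inserted ρ => ρ.properPrefixes
  | .finish => P.outer

/-- Propagation of a null reference: if the links in `S` are those that hold it before a step,
these are the links that hold it after the step. An assignment copies it; overwriting a link
removes it. The links that a callee can overwrite are used by the call. -/
def Proc.carry (P : Proc V F N Fn) (m : Mem V F) (S : Set (Link V F)) :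
    Step V F Fn → Set (Link V F)
  | .orig _ (.assign x y) =>
      {l | (m.link x ≠ some l ∧ l ∈ S) ∨ (m.link x = some l ∧ ∃ l' ∈ S, m.link y = some l')}
  | .orig _ (.alloc x) => {l ∈ S | m.link x ≠ some l}
  | .orig _ (.null x) => {l ∈ S | m.link x ≠ some l}
  | .orig _ (.call x _ ys) => {l ∈ S | m.link x ≠ some l ∧ l ∉ m.links (P.exposed ys)}
  | .orig _ _ => S
  | .inserted ρ => {l ∈ S | m.link ρ ≠ some l}
  | .finish => S

/-- The links that, after the execution of a sequence of steps, hold the null reference that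
was held by the links in `S` before. -/
noncomputable def Proc.track (P : Proc V F N Fn) (env : Env V F Fn) :
    List (Step V F Fn) → Mem V F → Set (Link V F) → Set (Link V F)
  | [], _, S => S
  | a :: as, m, S => {l | ∃ m', P.exec env m a = some m' ∧ l ∈ P.track env as m' (P.carry m S a)}

end Exec

end HRA

open HRA

/-!
Run the original and the modified program side by side, and let `m` and `n` be their memory
graphs at the same point `p` of the path. The invariant (`Sim`) is that `n` agrees with `m` in
every *live link*, that is, every link that a path in `L p` denotes in `m`. Everything a step
uses is denoted by paths whose prefixes are all live, so it looks the same in `n` as in `m`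
(`Sim.link_eq`). Hence the modified program raises no exception where the original one raises
none; in particular a callee is given the same view of the memory in both programs and behaves
in the same way (`Sim.execStmt`).

All information about aliases, availability and anticipability is only needed for the original
program. The may-aliases are sound there (`aliasSound_after`), and as liveness is closed under
link aliasing, whether a path is live depends on its link only (`AliasSound.linkClosed`). So an
inserted assignment, being to a path that is not live, writes to a link that is not live. It
raises no exception, because its base leads to an object in the original program: this is what
availability (`nonNull_stmtAvail`, forward along the path) and anticipability
(`nonNull_stmtAnt`, backward from the end of the path, which the original program reaches)
guarantee.

The links that hold the null reference of a given inserted assignment are never live (`Dead`):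
a link that is live after a statement was live before, or it has been written by the statement,
and then, for a copy, the link it was copied from was live (`mem_links_of_notMem_written`,
`Dead.carry`). As used links are live, none of them holds this reference.

Acyclicity ensures that writing the link of a path `x` does not change which link `x` denotes,
and that what lies behind `x` after `x = y` is what lay behind `y` before
(`Acyclic.link_eq_of_agree`, `Acyclic.target_ext'_eq`). The effect of a statement on an
arbitrary path is analysed by `same_or_crosses`: either the path avoids all changed links, or
it has a prefix that denotes one of them both before and after the statement.
-/

namespace HRA

/-! ### Access paths and the links they denote -/

namespace AP
variable {V F : Type*}

@[simp] theorem ext'_nil (ρ : AP V F) : ρ.ext' [] = ρ := by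
  simp [ext']

@[simp] theorem ext'_ext' (ρ : AP V F) (σ σ' : List F) :
    (ρ.ext' σ).ext' σ' = ρ.ext' (σ ++ σ') := by
  simp [ext']

/-- Induction over access paths, from the root variable, one field at a time. -/
theorem snocInduction {p : AP V F → Prop} (root : ∀ v, p ⟨v, []⟩)
    (snoc : ∀ ρ f, p ρ → p (ρ.ext' [f])) (ρ : AP V F) : p ρ := by
  obtain ⟨v, σ⟩ := ρ
  induction σ using List.reverseRecOn with
  | nil => exact root v
  | append_singleton σ f ih => exact snoc ⟨v, σ⟩ f ih

theorem mem_prefixes_self (ρ : AP V F) : ρ ∈ ρ.prefixes := ⟨[], by simp⟩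

theorem mem_prefixes_ext' {τ ρ : AP V F} (h : τ ∈ ρ.prefixes) (σ : List F) :
    τ ∈ (ρ.ext' σ).prefixes := by
  obtain ⟨σ', rfl⟩ := h
  exact ⟨σ' ++ σ, by simp⟩

theorem properPrefixes_subset (ρ : AP V F) : ρ.properPrefixes ⊆ ρ.prefixes := by
  rintro τ ⟨σ, -, h⟩
  exact ⟨σ, h⟩

theorem mem_prefixes_iff {τ ρ : AP V F} : τ ∈ ρ.prefixes ↔ τ = ρ ∨ τ ∈ ρ.properPrefixes := by
  constructor
  · rintro ⟨σ, rfl⟩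
    rcases eq_or_ne σ [] with rfl | h
    · simp
    · exact .inr ⟨σ, h, rfl⟩
  · rintro (rfl | h)
    · exact mem_prefixes_self _
    · exact properPrefixes_subset _ h

theorem properPrefixes_root (v : V) : (⟨v, []⟩ : AP V F).properPrefixes = ∅ := by
  ext τ
  refine iff_of_false ?_ (Set.notMem_empty τ)
  rintro ⟨σ, hσ, h⟩
  simp [ext', AP.ext_iff] at h
  exact hσ h.2.2

theorem properPrefixes_snoc (ρ : AP V F) (f : F) : (ρ.ext' [f]).properPrefixes = ρ.prefixes := by
  ext τ
  constructor
  · rintro ⟨σ, hσ, h⟩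
    obtain ⟨σ', g, rfl⟩ := List.eq_nil_or_concat σ |>.resolve_left hσ
    refine ⟨σ', ?_⟩
    simp [ext', AP.ext_iff, ← List.append_assoc] at h ⊢
    exact ⟨h.1, h.2.1⟩
  · rintro ⟨σ, rfl⟩
    exact ⟨σ ++ [f], by simp, by simp⟩

theorem prefixes_trans {τ ρ υ : AP V F} (h : τ ∈ ρ.prefixes) (h' : ρ ∈ υ.prefixes) :
    τ ∈ υ.prefixes := by
  obtain ⟨σ, rfl⟩ := h'
  exact mem_prefixes_ext' h σ

theorem properPrefixes_of_mem_prefixes {τ ρ υ : AP V F} (h : τ ∈ ρ.prefixes)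
    (h' : ρ ∈ υ.properPrefixes) : τ ∈ υ.properPrefixes := by
  obtain ⟨σ, rfl⟩ := h
  obtain ⟨σ', hσ', rfl⟩ := h'
  exact ⟨σ ++ σ', by simp [hσ'], by simp⟩

theorem base_snoc (ρ : AP V F) (f : F) : (ρ.ext' [f]).base = ρ := by
  simp [ext', base]

end AP

namespace Mem
variable {V F : Type*}

/-- The reference that a link holds. -/
def val (m : Mem V F) : Link V F → Option ℕ
  | .var v => m.var v
  | .field n f => m.field n f

@[simp] theorem val_var (m : Mem V F) (v : V) : m.val (.var v) = m.var v := rfl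
@[simp] theorem val_field (m : Mem V F) (n : ℕ) (f : F) : m.val (.field n f) = m.field n f := rfl

@[simp] theorem link_root (m : Mem V F) (v : V) : m.link ⟨v, []⟩ = some (.var v) := rfl

@[simp] theorem link_snoc (m : Mem V F) (ρ : AP V F) (f : F) :
    m.link (ρ.ext' [f]) = (m.target ρ).map fun n => .field n f := by
  simp only [link]
  rw [AP.base_snoc]
  simp [AP.ext']

@[simp] theorem target_root (m : Mem V F) (v : V) : m.target ⟨v, []⟩ = m.var v := rfl

@[simp] theorem target_snoc (m : Mem V F) (ρ : AP V F) (f : F) :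
    m.target (ρ.ext' [f]) = (m.target ρ).bind fun n => m.field n f := by
  simp [target, AP.ext', List.foldl_append]

theorem target_eq_link_bind (m : Mem V F) (ρ : AP V F) : m.target ρ = (m.link ρ).bind m.val := by
  induction ρ using AP.snocInduction with
  | root v => simp
  | snoc ρ f _ => cases h : m.target ρ <;> simp [h]

theorem target_eq_val {m : Mem V F} {ρ : AP V F} {l : Link V F} (h : m.link ρ = some l) :
    m.target ρ = m.val l := by
  rw [target_eq_link_bind, h]; rfl

theorem exists_link_of_target {m : Mem V F} {ρ : AP V F} {n : ℕ} (h : m.target ρ = some n) :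
    ∃ l, m.link ρ = some l ∧ m.val l = some n := by
  rw [target_eq_link_bind] at h
  exact Option.bind_eq_some_iff.1 h

/-- Only the root variable itself denotes the link of a variable. -/
theorem link_eq_var {m : Mem V F} {ρ : AP V F} {v : V} (h : m.link ρ = some (.var v)) :
    ρ = ⟨v, []⟩ := by
  induction ρ using AP.snocInduction with
  | root w => simp at h; rw [h]
  | snoc ρ f _ => simp at h

theorem link_eq_field {m : Mem V F} {ρ : AP V F} {n : ℕ} {f : F}
    (h : m.link ρ = some (.field n f)) : ∃ τ, ρ = τ.ext' [f] ∧ m.target τ = some n := by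
  induction ρ using AP.snocInduction with
  | root w => simp at h
  | snoc ρ g _ =>
    simp at h
    obtain ⟨h, rfl⟩ := h
    exact ⟨ρ, rfl, h⟩

theorem target_ext'_congr {m : Mem V F} {ρ ρ' : AP V F} (h : m.target ρ = m.target ρ')
    (σ : List F) : m.target (ρ.ext' σ) = m.target (ρ'.ext' σ) := by
  induction σ using List.reverseRecOn with
  | nil => simpa using h
  | append_singleton σ f ih => rw [← AP.ext'_ext', ← AP.ext'_ext', target_snoc, target_snoc, ih]

theorem target_ne_none_of_mem_properPrefixes {m : Mem V F} {ρ τ : AP V F}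
    (h : m.link ρ ≠ none) (hτ : τ ∈ ρ.properPrefixes) : m.target τ ≠ none := by
  induction ρ using AP.snocInduction generalizing τ with
  | root v => simp [AP.properPrefixes_root] at hτ
  | snoc ρ f ih =>
    rw [AP.properPrefixes_snoc, AP.mem_prefixes_iff] at hτ
    have hρ : m.target ρ ≠ none := by
      intro h0; simp [h0] at h
    rcases hτ with rfl | hτ
    · exact hρ
    · refine ih (fun h0 => hρ ?_) hτ
      rw [target_eq_link_bind, h0]; rfl

theorem link_ne_none_of_target {m : Mem V F} {ρ : AP V F} (h : m.target ρ ≠ none) :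
    m.link ρ ≠ none := by
  intro h0
  rw [target_eq_link_bind, h0] at h
  exact h rfl

theorem target_ne_none_of_mem_prefixes {m : Mem V F} {ρ τ : AP V F}
    (h : m.target ρ ≠ none) (hτ : τ ∈ ρ.prefixes) : m.target τ ≠ none := by
  rcases AP.mem_prefixes_iff.1 hτ with rfl | hτ
  · exact h
  · exact target_ne_none_of_mem_properPrefixes (link_ne_none_of_target h) hτ

/-- In an acyclic memory graph, a path passes through the link that it denotes only once. -/
theorem Acyclic.ext'_eq_nil {m : Mem V F} (hm : m.Acyclic) {τ : AP V F} {σ : List F}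
    {l : Link V F} (h₁ : m.link τ = some l) (h₂ : m.link (τ.ext' σ) = some l) : σ = [] := by
  cases l with
  | var v =>
    have h := link_eq_var h₂
    simp [AP.ext', AP.ext_iff] at h
    exact h.2.2
  | field n f =>
    obtain ⟨τ', rfl, h₃⟩ := link_eq_field h₁
    by_contra hσ
    obtain ⟨σ', g, rfl⟩ := List.eq_nil_or_concat σ |>.resolve_left hσ
    rw [List.concat_eq_append, ← AP.ext'_ext', link_snoc] at h₂
    simp at h₂
    exact hm τ' (f :: σ') n (by simp) h₃ (by simpa using h₂.1)

/-- In two memory graphs that agree off a set `W` of links, a path denotes the same link and has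
the same target, unless it has a prefix that denotes a link in `W`. The shortest such prefix
denotes this link in both memory graphs. -/
theorem same_or_crosses {m m₁ : Mem V F} {W : Set (Link V F)}
    (h : ∀ l ∉ W, m₁.val l = m.val l) (ρ : AP V F) :
    (m₁.link ρ = m.link ρ ∧ m₁.target ρ = m.target ρ ∧
      ∀ τ ∈ ρ.prefixes, ∀ l ∈ W, m.link τ ≠ some l) ∨
    ∃ τ σ, ρ = τ.ext' σ ∧ ∃ l ∈ W, m.link τ = some l ∧ m₁.link τ = some l := by
  -- it suffices to treat the last link of a path whose proper prefixes do not meet `W`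
  have key : ∀ ρ : AP V F, m₁.link ρ = m.link ρ →
      (∀ τ ∈ ρ.properPrefixes, ∀ l ∈ W, m.link τ ≠ some l) →
      (m₁.link ρ = m.link ρ ∧ m₁.target ρ = m.target ρ ∧
        ∀ τ ∈ ρ.prefixes, ∀ l ∈ W, m.link τ ≠ some l) ∨
      ∃ τ σ, ρ = τ.ext' σ ∧ ∃ l ∈ W, m.link τ = some l ∧ m₁.link τ = some l := by
    intro ρ hρ hp
    by_cases hW : ∃ l ∈ W, m.link ρ = some l
    · obtain ⟨l, hl, hl'⟩ := hW
      exact .inr ⟨ρ, [], by simp, l, hl, hl', hρ.trans hl'⟩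
    · push Not at hW
      refine .inl ⟨hρ, ?_, fun τ hτ => ?_⟩
      · rw [target_eq_link_bind, target_eq_link_bind, hρ]
        cases hl : m.link ρ with
        | none => rfl
        | some l => exact h l fun hlW => hW l hlW hl
      · rcases AP.mem_prefixes_iff.1 hτ with rfl | hτ
        · exact hW
        · exact hp τ hτ
  induction ρ using AP.snocInduction with
  | root v => exact key _ rfl (by simp [AP.properPrefixes_root])
  | snoc ρ f ih =>
    rcases ih with ⟨-, ht, hp⟩ | ⟨τ, σ, rfl, hl⟩
    · exact key _ (by simp [ht]) (by rwa [AP.properPrefixes_snoc])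
    · exact .inr ⟨τ, σ ++ [f], by simp, hl⟩

/-- Overwriting the link of `x` leaves the link of `x` in place. -/
theorem Acyclic.link_eq_of_agree {m m₁ : Mem V F} (hm : m.Acyclic) {x : AP V F} {lx : Link V F}
    (hx : m.link x = some lx) (h : ∀ l, l ≠ lx → m₁.val l = m.val l) : m₁.link x = some lx := by
  rcases same_or_crosses (W := {lx}) (m := m) (m₁ := m₁) (by simpa using h) x with
    ⟨h, -, -⟩ | ⟨τ, σ, rfl, l, rfl, h, h'⟩
  · rw [h, hx]
  · obtain rfl := hm.ext'_eq_nil h hx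
    simpa using h'

/-- What lies behind `x` after `α_x = α_y` lay behind `y` before it: otherwise the link of `x`
would be reached again from its own target. -/
theorem Acyclic.target_ext'_eq {m m₁ : Mem V F} (hm₁ : m₁.Acyclic) {x y : AP V F}
    {lx : Link V F} (hx : m₁.link x = some lx) (h : ∀ l, l ≠ lx → m₁.val l = m.val l)
    (hxy : m₁.target x = m.target y) (σ : List F) :
    m₁.target (x.ext' σ) = m.target (y.ext' σ) := by
  induction σ using List.reverseRecOn with
  | nil => simpa using hxy
  | append_singleton σ f ih =>
    rw [← AP.ext'_ext', ← AP.ext'_ext', target_snoc, target_snoc, ih]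
    cases hk : m.target (y.ext' σ) with
    | none => rfl
    | some k =>
      refine h (.field k f) fun hl => ?_
      have : m₁.link (x.ext' (σ ++ [f])) = some lx := by
        rw [← AP.ext'_ext', link_snoc, ih, hk, ← hl]; rfl
      simpa using hm₁.ext'_eq_nil hx this

theorem val_write_self (m : Mem V F) (l : Link V F) (v : Option ℕ) : (m.write l v).val l = v := by
  cases l <;> simp [val, write]

theorem val_write_of_ne (m : Mem V F) {l l' : Link V F} (v : Option ℕ) (h : l' ≠ l) :
    (m.write l v).val l' = m.val l' := by
  cases l' <;> simp [val, write, h.symm]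

/-- The links of variables and of allocated objects. -/
def Allocated (m : Mem V F) : Set (Link V F) :=
  {l | ∀ n f, l = .field n f → n < m.next}

theorem Valid.target_lt {m : Mem V F} (hm : m.Valid) {ρ : AP V F} {n : ℕ}
    (h : m.target ρ = some n) : n < m.next := by
  obtain ⟨l, -, hl⟩ := exists_link_of_target h
  cases l with
  | var v => exact hm.1 _ _ hl
  | field k f => exact (hm.2 _ _ _ hl).2

theorem Valid.link_mem_allocated {m : Mem V F} (hm : m.Valid) {ρ : AP V F} {l : Link V F}
    (h : m.link ρ = some l) : l ∈ m.Allocated := by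
  rintro n f rfl
  obtain ⟨τ, -, hτ⟩ := link_eq_field h
  exact hm.target_lt hτ

theorem Valid.write {m : Mem V F} (hm : m.Valid) {l : Link V F} (hl : l ∈ m.Allocated)
    {v : Option ℕ} (hv : ∀ n, v = some n → n < m.next) : (m.write l v).Valid := by
  refine ⟨fun x n h => ?_, fun k f n h => ?_⟩
  · by_cases hx : l = .var x
    · exact hv n (by simpa [Mem.write, hx] using h)
    · exact hm.1 x n (by simpa [Mem.write, hx] using h)
  · by_cases hx : l = .field k f
    · exact ⟨hl k f hx, hv n (by simpa [Mem.write, hx] using h)⟩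
    · exact hm.2 k f n (by simpa [Mem.write, hx] using h)

end Mem

/-! ### What a statement changes in the memory graph -/

open Mem
variable {V F N Fn : Type*} {P : Proc V F N Fn} {env : Env V F Fn} {k : ℕ} {m m₁ : Mem V F}

theorem execStmt_call_eq_some {x : AP V F} {f : Fn} {ys : List (AP V F)}
    (h : P.execStmt env k m (.call x f ys) = some m₁) :
    ∃ l, m.link x = some l ∧ (∀ y ∈ ys, m.link y ≠ none) ∧ ∃ m' v,
      env k f (P.view m (m.objects (P.passed ys))) (ys.map m.target) = some (m', v) ∧
      P.Admissible m (m.objects (P.passed ys)) m' v ∧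
      m₁ = (P.overlay m (m.objects (P.passed ys)) m').write l v := by
  simp only [Proc.execStmt] at h
  obtain ⟨l, hl, h⟩ := Option.bind_eq_some_iff.1 h
  split_ifs at h with hy
  obtain ⟨⟨m', v⟩, hr, h⟩ := Option.bind_eq_some_iff.1 h
  split_ifs at h with ha
  exact ⟨l, hl, hy, m', v, hr, ha, (Option.some.inj h).symm⟩

theorem root_mem_passed {v : V} (ys : List (AP V F)) (hv : v ∈ P.globals) :
    (⟨v, []⟩ : AP V F) ∈ P.passed ys := .inl hv

theorem ext'_mem_passed {ys : List (AP V F)} {θ : AP V F} (h : θ ∈ P.passed ys) (σ : List F) :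
    θ.ext' σ ∈ P.passed ys := by
  rcases h with h | ⟨y, hy, σ', rfl⟩
  · exact .inl h
  · exact .inr ⟨y, hy, σ' ++ σ, by simp⟩

theorem snoc_mem_exposed {ys : List (AP V F)} {θ : AP V F} (h : θ ∈ P.passed ys) (f : F) :
    θ.ext' [f] ∈ P.exposed ys := by
  rcases h with h | ⟨y, hy, σ', rfl⟩
  · exact .inl h
  · exact .inr ⟨y, hy, σ' ++ [f], by simp, by simp⟩

/-- The links exposed to a callee are those of the globals and of the objects passed to it. -/
theorem exposed_link {ys : List (AP V F)} {l : Link V F} (h : l ∈ m.links (P.exposed ys)) :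
    (∃ v ∈ P.globals, l = .var v) ∨
      ∃ n f, n ∈ m.objects (P.passed ys) ∧ l = .field n f := by
  obtain ⟨θ, hθ, h⟩ := h
  cases l with
  | var v =>
    obtain rfl := link_eq_var h
    rcases hθ with hθ | ⟨y, -, hy⟩
    · exact .inl ⟨v, hθ, rfl⟩
    · simp [AP.properPrefixes_root] at hy
  | field n f =>
    obtain ⟨τ, rfl, hτ⟩ := link_eq_field h
    refine .inr ⟨n, f, ⟨τ, ?_, hτ⟩, rfl⟩
    rcases hθ with hθ | ⟨y, hy, hθ⟩
    · exact .inl hθ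
    · rw [AP.properPrefixes_snoc] at hθ
      exact .inr ⟨y, hy, hθ⟩

/-- The links that a statement may change: the link of the path it assigns and, for a call,
the links that are exposed to the callee and those of objects that the callee creates. -/
def Proc.written (P : Proc V F N Fn) (m : Mem V F) (s : Stmt V F Fn) : Set (Link V F) :=
  {l | (∃ x, s.lhs = some x ∧ m.link x = some l) ∨
    ∃ x f ys, s = .call x f ys ∧ (l ∈ m.links (P.exposed ys) ∨ l ∉ m.Allocated)}

theorem overlay_val_eq {R : Set ℕ} {m' : Mem V F} {ys : List (AP V F)} {l : Link V F}
    (hR : R = m.objects (P.passed ys)) (hl : l ∉ m.links (P.exposed ys)) (ha : l ∈ m.Allocated) :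
    (P.overlay m R m').val l = m.val l := by
  subst hR
  cases l with
  | var v =>
    have : v ∉ P.globals := fun hv => hl ⟨⟨v, []⟩, .inl hv, rfl⟩
    simp [Proc.overlay, this]
  | field n f =>
    have h₁ : n ∉ m.objects (P.passed ys) := by
      rintro ⟨θ, hθ, hn⟩
      exact hl ⟨θ.ext' [f], snoc_mem_exposed hθ f, by simp [hn]⟩
    have h₂ := ha n f rfl
    simp [Proc.overlay, h₁, h₂]

theorem execStmt_val_eq {s : Stmt V F Fn} (h : P.execStmt env k m s = some m₁) {l : Link V F}
    (hl : l ∉ P.written m s) : m₁.val l = m.val l := by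
  have hx : ∀ x lx, s.lhs = some x → m.link x = some lx → l ≠ lx := by
    rintro x lx h₁ h₂ rfl
    exact hl (.inl ⟨x, h₁, h₂⟩)
  cases s with
  | assign x y =>
    obtain ⟨lx, hlx, h⟩ := Option.bind_eq_some_iff.1 h
    obtain ⟨_, -, rfl⟩ := Option.map_eq_some_iff.1 h
    exact val_write_of_ne _ _ (hx x lx rfl hlx)
  | alloc x =>
    obtain ⟨lx, hlx, rfl⟩ := Option.map_eq_some_iff.1 h
    have := val_write_of_ne m (some m.next) (hx x lx rfl hlx)
    cases l <;> exact this
  | null x =>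
    obtain ⟨lx, hlx, rfl⟩ := Option.map_eq_some_iff.1 h
    exact val_write_of_ne _ _ (hx x lx rfl hlx)
  | call x f ys =>
    obtain ⟨lx, hlx, -, m', v, -, -, rfl⟩ := execStmt_call_eq_some h
    rw [val_write_of_ne _ _ (hx x lx rfl hlx)]
    refine overlay_val_eq rfl (fun h' => hl (.inr ⟨x, f, ys, rfl, .inl h'⟩)) ?_
    by_contra h'
    exact hl (.inr ⟨x, f, ys, rfl, .inr h'⟩)
  | use ys =>
    simp only [Proc.execStmt] at h
    split_ifs at h
    rw [Option.some.inj h]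
  | ret z =>
    obtain ⟨_, -, rfl⟩ := Option.map_eq_some_iff.1 h
    rfl
  | other => rw [Option.some.inj h]

theorem execStmt_next_le {s : Stmt V F Fn} (h : P.execStmt env k m s = some m₁) :
    m.next ≤ m₁.next := by
  cases s with
  | assign x y =>
    obtain ⟨lx, hlx, h⟩ := Option.bind_eq_some_iff.1 h
    obtain ⟨_, -, rfl⟩ := Option.map_eq_some_iff.1 h
    exact le_rfl
  | alloc x =>
    obtain ⟨lx, hlx, rfl⟩ := Option.map_eq_some_iff.1 h
    exact Nat.le_succ _
  | null x =>
    obtain ⟨lx, hlx, rfl⟩ := Option.map_eq_some_iff.1 h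
    exact le_rfl
  | call x f ys =>
    obtain ⟨lx, hlx, -, m', v, -, ha, rfl⟩ := execStmt_call_eq_some h
    exact ha.1
  | use ys =>
    simp only [Proc.execStmt] at h
    split_ifs at h
    rw [Option.some.inj h]
  | ret z =>
    obtain ⟨_, -, rfl⟩ := Option.map_eq_some_iff.1 h
    exact le_rfl
  | other => rw [Option.some.inj h]

theorem objects_lt (hm : m.Valid) {X : Set (AP V F)} {n : ℕ} (h : n ∈ m.objects X) :
    n < m.next := by
  obtain ⟨θ, -, h⟩ := h
  exact hm.target_lt h

theorem overlay_valid (hm : m.Valid) {R : Set ℕ} (hR : ∀ n ∈ R, n < m.next) {m' : Mem V F}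
    {v : Option ℕ} (ha : P.Admissible m R m' v) : (P.overlay m R m').Valid := by
  obtain ⟨hle, -, hvar, hfield, hnew⟩ := ha
  have hlt : ∀ n, (n ∈ R ∨ m.next ≤ n ∧ n < m'.next) → n < m'.next := by
    rintro n (h | h)
    · exact (hR n h).trans_le hle
    · exact h.2
  refine ⟨fun x n h => ?_, fun j f n h => ?_⟩
  · simp only [Proc.overlay] at h ⊢
    split_ifs at h with hx
    · exact hlt n (hvar x hx n h)
    · exact (hm.1 x n h).trans_le hle
  · simp only [Proc.overlay] at h ⊢
    split_ifs at h with hj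
    · refine ⟨?_, hlt n (hfield j f hj n h)⟩
      by_contra hj'
      simp [hnew j f (not_lt.1 hj')] at h
    · exact ⟨(hm.2 j f n h).1.trans_le hle, (hm.2 j f n h).2.trans_le hle⟩

theorem execStmt_valid (hm : m.Valid) {s : Stmt V F Fn}
    (h : P.execStmt env k m s = some m₁) : m₁.Valid := by
  cases s with
  | assign x y =>
    obtain ⟨lx, hlx, h⟩ := Option.bind_eq_some_iff.1 h
    obtain ⟨_, -, rfl⟩ := Option.map_eq_some_iff.1 h
    exact hm.write (hm.link_mem_allocated hlx) fun n => hm.target_lt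
  | alloc x =>
    obtain ⟨lx, hlx, rfl⟩ := Option.map_eq_some_iff.1 h
    have hm' : ({ m with next := m.next + 1 } : Mem V F).Valid :=
      ⟨fun x n h => (hm.1 x n h).trans (Nat.lt_succ_self _),
        fun j f n h => ⟨(hm.2 j f n h).1.trans (Nat.lt_succ_self _),
          (hm.2 j f n h).2.trans (Nat.lt_succ_self _)⟩⟩
    refine hm'.write (l := lx) (v := some m.next) (fun n f hl => ?_) fun n hn => ?_
    · exact (hm.link_mem_allocated hlx n f hl).trans (Nat.lt_succ_self _)
    · rw [← Option.some.inj hn]; exact Nat.lt_succ_self _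
  | null x =>
    obtain ⟨lx, hlx, rfl⟩ := Option.map_eq_some_iff.1 h
    exact hm.write (hm.link_mem_allocated hlx) (by simp)
  | call x f ys =>
    obtain ⟨lx, hlx, -, m', v, -, ha, rfl⟩ := execStmt_call_eq_some h
    refine (overlay_valid hm (fun n => objects_lt hm) ha).write (fun n f hl => ?_)
      fun n hn => ?_
    · exact (hm.link_mem_allocated hlx n f hl).trans_le ha.1
    · rcases ha.2.1 n hn with h | h
      · exact (objects_lt hm h).trans_le ha.1
      · exact h.2
  | use ys =>
    simp only [Proc.execStmt] at h
    split_ifs at h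
    rwa [← Option.some.inj h]
  | ret z =>
    obtain ⟨_, -, rfl⟩ := Option.map_eq_some_iff.1 h
    exact hm
  | other => rwa [← Option.some.inj h]

/-! ### Soundness of the may-aliases -/

/-- The relation `R` contains all pairs of paths that lead to the same object. -/
def AliasSound (m : Mem V F) (R : AP V F → AP V F → Prop) : Prop :=
  ∀ ρ ρ' n, m.target ρ = some n → m.target ρ' = some n → R ρ ρ'

theorem AliasSound.mem_linkAliases {R : AP V F → AP V F → Prop} (hR : AliasSound m R)
    {ρ ρ' : AP V F} {l : Link V F} (h : m.link ρ = some l) (h' : m.link ρ' = some l) :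
    ρ' ∈ linkAliases R ρ := by
  cases l with
  | var v => exact .inl ((link_eq_var h').trans (link_eq_var h).symm)
  | field n f =>
    obtain ⟨τ, rfl, hτ⟩ := link_eq_field h
    obtain ⟨τ', rfl, hτ'⟩ := link_eq_field h'
    exact .inr ⟨τ, τ', f, hR _ _ _ hτ hτ', rfl, rfl⟩

theorem mem_kill_of_written {R : AP V F → AP V F → Prop} (hm : m.Valid) (hR : AliasSound m R)
    {s : Stmt V F Fn} {ρ τ : AP V F} (hτ : τ ∈ ρ.prefixes) {l : Link V F}
    (hl : l ∈ P.written m s) (h : m.link τ = some l) : ρ ∈ P.kill R s := by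
  rcases hl with ⟨x, hx, hl⟩ | ⟨x, f, ys, hs, ⟨θ, hθ, hl⟩ | hl⟩
  · exact ⟨τ, hτ, .inl ⟨x, hx, hR.mem_linkAliases hl h⟩⟩
  · exact ⟨τ, hτ, .inr ⟨x, f, ys, hs, θ, hθ, hR.mem_linkAliases hl h⟩⟩
  · exact absurd (hm.link_mem_allocated h) hl

theorem target_eq_of_notMem_kill {R : AP V F → AP V F → Prop} (hm : m.Valid)
    (hR : AliasSound m R) {s : Stmt V F Fn} (h : P.execStmt env k m s = some m₁) {ρ : AP V F}
    (hρ : ρ ∉ P.kill R s) : m₁.target ρ = m.target ρ := by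
  rcases same_or_crosses (fun l => execStmt_val_eq (l := l) h) ρ with
    ⟨-, h, -⟩ | ⟨τ, σ, rfl, l, hl, hτ, -⟩
  · exact h
  · exact absurd (mem_kill_of_written hm hR ⟨σ, rfl⟩ hl hτ) hρ

section Call

/-- The objects that a callee can return references to: those it sees and those it creates. -/
def Proc.inner (P : Proc V F N Fn) (m : Mem V F) (ys : List (AP V F)) : Set ℕ :=
  {n | n ∈ m.objects (P.passed ys) ∨ m.next ≤ n}

variable {x : AP V F} {f : Fn} {ys : List (AP V F)}

theorem field_mem_written {n : ℕ} (hn : n ∈ P.inner m ys) (g : F) :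
    .field n g ∈ P.written m (.call x f ys) := by
  refine .inr ⟨x, f, ys, rfl, ?_⟩
  rcases hn with ⟨θ, hθ, hn⟩ | hn
  · exact .inl ⟨θ.ext' [g], snoc_mem_exposed hθ g, by simp [hn]⟩
  · exact .inr fun h => (h n g rfl).not_ge hn

/-- The links that a call changes are those of the result, of globals, and of objects that the
callee sees or creates. -/
theorem written_call {l : Link V F} (h : l ∈ P.written m (.call x f ys)) :
    m.link x = some l ∨ (∃ v ∈ P.globals, l = .var v) ∨
      ∃ n g, n ∈ P.inner m ys ∧ l = .field n g := by
  rcases h with ⟨x', hx', h⟩ | ⟨x', f', ys', heq, h | h⟩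
  · cases hx'
    exact .inl h
  · cases heq
    exact .inr ((exposed_link h).imp_right fun ⟨n, g, hn, hl⟩ => ⟨n, g, .inl hn, hl⟩)
  · cases heq
    cases l with
    | var v => exact absurd (fun _ _ h => by cases h) h
    | field n g =>
      refine .inr (.inr ⟨n, g, .inr (not_lt.1 fun hn => h ?_), rfl⟩)
      rintro _ _ ⟨⟩
      exact hn

/-- The links of globals and of objects that the callee sees or creates only hold references
to such objects after the call, and so does the link of the result. -/
theorem mem_inner_of_val (h : P.execStmt env k m (.call x f ys) = some m₁) {l : Link V F}
    (hl : m.link x = some l ∨ (∃ v ∈ P.globals, l = .var v) ∨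
      ∃ n g, n ∈ P.inner m ys ∧ l = .field n g) {n : ℕ} (hn : m₁.val l = some n) :
    n ∈ P.inner m ys := by
  obtain ⟨lx, hlx, -, m', v, -, ha, rfl⟩ := execStmt_call_eq_some h
  have key : ∀ n, (n ∈ m.objects (P.passed ys) ∨ m.next ≤ n ∧ n < m'.next) →
      n ∈ P.inner m ys := fun n h => h.imp_right And.left
  by_cases hlx' : l = lx
  · subst hlx'
    rw [val_write_self] at hn
    exact key _ (ha.2.1 n hn)
  rw [val_write_of_ne _ _ hlx'] at hn
  rcases hl with hl | ⟨w, hw, rfl⟩ | ⟨j, g, hj, rfl⟩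
  · exact absurd (Option.some.inj (hl.symm.trans hlx)) hlx'
  · simp only [Proc.overlay, val_var, if_pos hw] at hn
    exact key _ (ha.2.2.1 w hw n hn)
  · have hj' : j ∈ m.objects (P.passed ys) ∨ m.next ≤ j := hj
    simp only [Proc.overlay, val_field, if_pos hj'] at hn
    exact key _ (ha.2.2.2.1 j g hj' n hn)

theorem mem_inner_ext' (h : P.execStmt env k m (.call x f ys) = some m₁) {τ : AP V F}
    {n : ℕ} (hτ : m₁.target τ = some n) (hn : n ∈ P.inner m ys) (σ : List F) {n' : ℕ}
    (hn' : m₁.target (τ.ext' σ) = some n') : n' ∈ P.inner m ys := by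
  induction σ using List.reverseRecOn generalizing n' with
  | nil =>
    rw [AP.ext'_nil, hτ] at hn'
    rwa [← Option.some.inj hn']
  | append_singleton σ g ih =>
    rw [← AP.ext'_ext', target_snoc] at hn'
    obtain ⟨j, hj, hn'⟩ := Option.bind_eq_some_iff.1 hn'
    exact mem_inner_of_val h (l := .field j g) (.inr (.inr ⟨j, g, ih hj, rfl⟩)) hn'

/-- After a call, a path either is `touched` and leads to an object that the callee sees or
creates, or it leads, as before the call, to an object that the callee knows nothing about. -/
theorem call_target {R : AP V F → AP V F → Prop} (hm : m.Valid) (hR : AliasSound m R)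
    (hrefl : ∀ ρ, R ρ ρ) (h : P.execStmt env k m (.call x f ys) = some m₁) (ρ : AP V F)
    {n : ℕ} (hn : m₁.target ρ = some n) :
    (ρ ∈ P.touched R x ys ∧ n ∈ P.inner m ys) ∨ (n ∉ P.inner m ys ∧ m.target ρ = some n) := by
  -- the last link of a path is the same before the call, and the callee does not see it
  have last : ∀ ρ l n, m.link ρ = some l → l ∉ m.links (P.exposed ys) → m₁.val l = some n →
      (ρ ∈ P.touched R x ys ∧ n ∈ P.inner m ys) ∨
        (n ∉ P.inner m ys ∧ m.target ρ = some n) := by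
    intro ρ l n hl hle hn
    by_cases hlx : m.link x = some l
    · exact .inl ⟨⟨ρ, AP.mem_prefixes_self ρ, .inl (hR.mem_linkAliases hlx hl)⟩,
        mem_inner_of_val h (.inl hlx) hn⟩
    · have hW : l ∉ P.written m (.call x f ys) := by
        rintro (⟨x', hx', hl'⟩ | ⟨x', f', ys', heq, hl'⟩)
        · obtain rfl := Option.some.inj hx'
          exact hlx hl'
        · cases heq
          exact hl'.elim hle fun h => h (hm.link_mem_allocated hl)
      rw [execStmt_val_eq h hW, ← target_eq_val hl] at hn
      by_cases hi : n ∈ P.inner m ys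
      · refine .inl ⟨⟨ρ, AP.mem_prefixes_self ρ, .inr ?_⟩, hi⟩
        obtain ⟨θ, hθ, hi⟩ := hi.resolve_right (not_le.2 (hm.target_lt hn))
        exact ⟨θ, hθ, hR _ _ _ hi hn⟩
      · exact .inr ⟨hi, hn⟩
  induction ρ using AP.snocInduction generalizing n with
  | root v =>
    by_cases hv : v ∈ P.globals
    · exact .inl ⟨⟨_, AP.mem_prefixes_self _, .inr ⟨_, root_mem_passed ys hv, hrefl _⟩⟩,
        mem_inner_of_val h (l := .var v) (.inr (.inl ⟨v, hv, rfl⟩)) hn⟩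
    · by_cases hle : Link.var v ∈ m.links (P.exposed ys)
      · rcases exposed_link hle with ⟨w, hw, heq⟩ | ⟨_, _, -, heq⟩ <;> cases heq
        exact absurd hw hv
      · exact last _ (.var v) n rfl hle hn
  | snoc ρ g ih =>
    rw [target_snoc] at hn
    obtain ⟨j, hj, hn⟩ := Option.bind_eq_some_iff.1 hn
    rcases ih hj with ⟨⟨τ, hτ, ht⟩, hi⟩ | ⟨hi, hj'⟩
    · exact .inl ⟨⟨τ, AP.mem_prefixes_ext' hτ _, ht⟩,
        mem_inner_of_val h (l := .field j g) (.inr (.inr ⟨j, g, hi, rfl⟩)) hn⟩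
    · refine last _ (.field j g) n (by simp [hj']) ?_ hn
      intro hle
      rcases exposed_link hle with ⟨_, -, heq⟩ | ⟨_, _, hj, heq⟩ <;> cases heq
      exact hi (.inl hj)

end Call

/-- If the heap is acyclic after an assignment, the object that a path then leads to is the one
that an `Origin` of the path led to before. -/
theorem exists_origin {R : AP V F → AP V F → Prop} (hR : AliasSound m R)
    (hm₁ : m₁.Acyclic) {x y : AP V F} (h : P.execStmt env k m (.assign x y) = some m₁)
    (ρ : AP V F) :
    ∃ ρ', Origin (Fn := Fn) R (.assign x y) ρ ρ' ∧ m₁.target ρ = m.target ρ' := by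
  obtain ⟨lx, hlx, h⟩ := Option.bind_eq_some_iff.1 h
  obtain ⟨_, -, rfl⟩ := Option.map_eq_some_iff.1 h
  have hval : ∀ l, l ≠ lx → (m.write lx (m.target y)).val l = m.val l :=
    fun l => val_write_of_ne m _
  rcases same_or_crosses (W := {lx}) (by simpa using hval) ρ with
    ⟨-, ht, -⟩ | ⟨τ, σ, rfl, l, rfl, hτ, hτ'⟩
  · exact ⟨ρ, .same ρ, ht⟩
  · refine ⟨y.ext' σ, .copy σ rfl (hR.mem_linkAliases hlx hτ), ?_⟩
    refine hm₁.target_ext'_eq hτ' hval ?_ σ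
    rw [target_eq_val hτ', val_write_self]

/-- The new object has no outgoing references, so a path to an object that passes through the
link assigned by `α_x = new` ends there. -/
theorem alloc_ext' (hm : m.Valid) {x τ : AP V F} (h : P.execStmt env k m (.alloc x) = some m₁)
    {l : Link V F} (hx : m.link x = some l) (hτ : m₁.link τ = some l) {σ : List F} {n : ℕ}
    (hn : m₁.target (τ.ext' σ) = some n) : σ = [] ∧ n = m.next := by
  obtain ⟨lx, hlx, rfl⟩ := Option.map_eq_some_iff.1 h
  obtain rfl := Option.some.inj (hlx.symm.trans hx)
  have hlx₁ : ∀ f, lx ≠ .field m.next f := by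
    rintro f rfl
    exact lt_irrefl _ (hm.link_mem_allocated hlx _ f rfl)
  have htτ := (target_eq_val hτ).trans
    (show _ = some m.next by
      have := val_write_self m lx (some m.next)
      cases lx <;> exact this)
  cases σ with
  | nil =>
    rw [AP.ext'_nil, htτ] at hn
    exact ⟨rfl, (Option.some.inj hn).symm⟩
  | cons f σ =>
    have : τ.ext' [f] ∈ (τ.ext' (f :: σ)).prefixes := ⟨σ, by simp⟩
    refine absurd ?_ (target_ne_none_of_mem_prefixes (m := _) (by rw [hn]; simp) this)
    rw [target_snoc, htτ]
    have h₁ : m.field m.next f = none := by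
      by_contra hne
      obtain ⟨j, hj⟩ := Option.ne_none_iff_exists'.1 hne
      exact lt_irrefl _ (hm.2 _ _ _ hj).1
    simpa [Mem.write, hlx₁ f] using h₁

/-- The new object is only reached through the link it was assigned to. -/
theorem alloc_target (hm : m.Valid) {x : AP V F}
    (h : P.execStmt env k m (.alloc x) = some m₁) {ρ : AP V F} {n : ℕ}
    (hn : m₁.target ρ = some n) :
    (n = m.next ∧ ∃ l, m.link x = some l ∧ m.link ρ = some l) ∨
      (n ≠ m.next ∧ m.target ρ = some n) := by
  rcases same_or_crosses (fun l => execStmt_val_eq (l := l) h) ρ with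
    ⟨-, ht, -⟩ | ⟨τ, σ, rfl, l, hl, hτ, hτ'⟩
  · rw [ht] at hn
    exact .inr ⟨(hm.target_lt hn).ne, hn⟩
  · rcases hl with ⟨x', hx', hl⟩ | ⟨_, _, _, heq, -⟩
    · obtain rfl := Option.some.inj hx'
      obtain ⟨rfl, rfl⟩ := alloc_ext' hm h hl hτ' hn
      exact .inl ⟨rfl, l, hl, by simpa using hτ⟩
    · cases heq

/-- After `α_x = null`, every path to an object avoids the link of `x`. -/
theorem null_target {x : AP V F} (h : P.execStmt env k m (.null x) = some m₁) {ρ : AP V F}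
    {n : ℕ} (hn : m₁.target ρ = some n) : m.target ρ = some n := by
  obtain ⟨lx, hlx, rfl⟩ := Option.map_eq_some_iff.1 h
  rcases same_or_crosses (W := {lx}) (m := m) (m₁ := m.write lx none)
    (by simpa using fun l => val_write_of_ne m none) ρ with
    ⟨-, ht, -⟩ | ⟨τ, σ, rfl, l, rfl, hτ, hτ'⟩
  · rwa [ht] at hn
  · refine absurd ?_ (target_ne_none_of_mem_prefixes (m := _) (by rw [hn]; simp)
      (⟨σ, rfl⟩ : τ ∈ (τ.ext' σ).prefixes))
    rw [target_eq_val hτ', val_write_self]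

theorem execStmt_eq_self {s : Stmt V F Fn} (hs : s.lhs = none)
    (h : P.execStmt env k m s = some m₁) : m₁ = m := by
  cases s with
  | use ys =>
    simp only [Proc.execStmt] at h
    split_ifs at h
    exact (Option.some.inj h).symm
  | ret z =>
    obtain ⟨_, -, rfl⟩ := Option.map_eq_some_iff.1 h
    rfl
  | other => exact (Option.some.inj h).symm
  | _ => simp [Stmt.lhs] at hs

theorem aliasSound_after {R R₁ : AP V F → AP V F → Prop} (hm : m.Valid) (hR : AliasSound m R)
    (hrefl : ∀ ρ, R ρ ρ) (hac₁ : m₁.Acyclic) {s : Stmt V F Fn}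
    (hflow : ∀ ρ ρ', P.aliasGen R s ρ ρ' → R₁ ρ ρ')
    (h : P.execStmt env k m s = some m₁) : AliasSound m₁ R₁ := by
  have same : ∀ {ρ ρ' n}, m.target ρ = some n → m.target ρ' = some n → R₁ ρ ρ' :=
    fun h h' => hflow _ _ (.inl ⟨_, _, .same _, .same _, hR _ _ _ h h'⟩)
  intro ρ ρ' n hn hn'
  cases s with
  | assign x y =>
    obtain ⟨τ, ho, ht⟩ := exists_origin hR hac₁ h ρ
    obtain ⟨τ', ho', ht'⟩ := exists_origin hR hac₁ h ρ'
    exact hflow _ _ (.inl ⟨τ, τ', ho, ho', hR _ _ n (ht ▸ hn) (ht' ▸ hn')⟩)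
  | alloc x =>
    rcases alloc_target hm h hn with ⟨h₀, l, hl, h₁⟩ | ⟨h₀, h₁⟩ <;>
      rcases alloc_target hm h hn' with ⟨h₀', l', hl', h₁'⟩ | ⟨h₀', h₁'⟩
    · exact hflow _ _ (.inr ⟨hR.mem_linkAliases hl h₁, hR.mem_linkAliases hl' h₁'⟩)
    · exact absurd h₀ h₀'
    · exact absurd h₀' h₀
    · exact same h₁ h₁'
  | null x => exact same (null_target h hn) (null_target h hn')
  | call x f ys =>
    rcases call_target hm hR hrefl h ρ hn with ⟨h₀, h₁⟩ | ⟨h₀, h₁⟩ <;>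
      rcases call_target hm hR hrefl h ρ' hn' with ⟨h₀', h₁'⟩ | ⟨h₀', h₁'⟩
    · exact hflow _ _ (.inr ⟨h₀, h₀'⟩)
    · exact absurd h₁ h₀'
    · exact absurd h₁' h₀
    · exact same h₁ h₁'
  | use ys => cases execStmt_eq_self rfl h; exact same hn hn'
  | ret z => cases execStmt_eq_self rfl h; exact same hn hn'
  | other => cases execStmt_eq_self rfl h; exact same hn hn'

/-! ### Soundness of availability and anticipability -/

/-- All paths in `X` lead to objects. -/
def NonNull (m : Mem V F) (X : Set (AP V F)) : Prop := ∀ ρ ∈ X, m.target ρ ≠ none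

theorem avDeref_subset_anDirect (s : Stmt V F Fn) : avDeref s ⊆ anDirect s := by
  cases s with
  | call x f ys => exact Set.subset_union_left
  | _ => exact subset_rfl

theorem nonNull_anDirect {s : Stmt V F Fn} (h : P.execStmt env k m s = some m₁) :
    NonNull m (anDirect s) := by
  have key : ∀ {x l}, m.link x = some l → ∀ ρ ∈ x.properPrefixes, m.target ρ ≠ none :=
    fun hx ρ => target_ne_none_of_mem_properPrefixes (by simp [hx])
  intro ρ hρ
  cases s with
  | assign x y =>
    obtain ⟨lx, hlx, h⟩ := Option.bind_eq_some_iff.1 h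
    obtain ⟨ly, hly, -⟩ := Option.map_eq_some_iff.1 h
    exact hρ.elim (key hlx ρ) (key hly ρ)
  | alloc x =>
    obtain ⟨lx, hlx, -⟩ := Option.map_eq_some_iff.1 h
    exact key hlx ρ hρ
  | null x =>
    obtain ⟨lx, hlx, -⟩ := Option.map_eq_some_iff.1 h
    exact key hlx ρ hρ
  | call x f ys =>
    obtain ⟨lx, hlx, hys, -⟩ := execStmt_call_eq_some h
    rcases hρ with hρ | ⟨y, hy, hρ⟩
    · exact key hlx ρ hρ
    · exact target_ne_none_of_mem_properPrefixes (hys y hy) hρ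
  | use ys =>
    simp only [Proc.execStmt] at h
    split_ifs at h with hys
    obtain ⟨y, hy, hρ⟩ := hρ
    exact target_ne_none_of_mem_prefixes (hys y hy) hρ
  | ret z =>
    obtain ⟨lz, hlz, -⟩ := Option.map_eq_some_iff.1 h
    exact key hlz ρ hρ
  | other => exact absurd hρ (Set.notMem_empty ρ)

theorem assign_target (hac : m.Acyclic) (hac₁ : m₁.Acyclic) {x y : AP V F}
    (h : P.execStmt env k m (.assign x y) = some m₁) (σ : List F) :
    m₁.target (x.ext' σ) = m.target (y.ext' σ) := by
  obtain ⟨lx, hlx, h⟩ := Option.bind_eq_some_iff.1 h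
  obtain ⟨_, -, rfl⟩ := Option.map_eq_some_iff.1 h
  have hval : ∀ l, l ≠ lx → (m.write lx (m.target y)).val l = m.val l :=
    fun l => val_write_of_ne m _
  have hx := hac.link_eq_of_agree hlx hval
  exact hac₁.target_ext'_eq hx hval (by rw [target_eq_val hx, val_write_self]) σ

theorem nonNull_stmtAvail {R : AP V F → AP V F → Prop} (hm : m.Valid) (hR : AliasSound m R)
    (hac : m.Acyclic) (hac₁ : m₁.Acyclic) {s : Stmt V F Fn}
    (h : P.execStmt env k m s = some m₁) {X : Set (AP V F)} (hX : NonNull m X) :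
    NonNull m₁ (P.stmtAvail R s X) := by
  rintro ρ ((⟨hρ, hk⟩ | hρ) | ⟨x, y, σ, rfl, hσ, rfl⟩)
  · rw [target_eq_of_notMem_kill hm hR h hk]
    exact hρ.elim (hX ρ) fun hρ => nonNull_anDirect h ρ (avDeref_subset_anDirect s hρ)
  · cases s with
    | alloc x =>
      obtain rfl : ρ = x := hρ
      obtain ⟨lx, hlx, rfl⟩ := Option.map_eq_some_iff.1 h
      have hval := fun l (hl : l ≠ lx) => val_write_of_ne m (some m.next) hl
      have hx := hac.link_eq_of_agree hlx hval
      have hx' : (m.write lx (some m.next)).target ρ ≠ none := by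
        rw [target_eq_val hx, val_write_self]; simp
      exact hx'
    | _ => exact absurd hρ (Set.notMem_empty ρ)
  · rw [assign_target hac hac₁ h]
    exact hX _ hσ

theorem linkAliases_mono {R R₁ : AP V F → AP V F → Prop} (hR : ∀ ρ ρ', R ρ ρ' → R₁ ρ ρ')
    (ρ : AP V F) : linkAliases R ρ ⊆ linkAliases R₁ ρ := by
  rintro ρ' (h | ⟨τ, τ', f, h, h', h''⟩)
  · exact .inl h
  · exact .inr ⟨τ, τ', f, hR _ _ h, h', h''⟩

theorem kill_mono {R R₁ : AP V F → AP V F → Prop} (hR : ∀ ρ ρ', R ρ ρ' → R₁ ρ ρ')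
    (s : Stmt V F Fn) : P.kill R s ⊆ P.kill R₁ s := by
  rintro ρ ⟨τ, hτ, ⟨x, hx, h⟩ | ⟨x, f, ys, hs, θ, hθ, h⟩⟩
  · exact ⟨τ, hτ, .inl ⟨x, hx, linkAliases_mono hR _ h⟩⟩
  · exact ⟨τ, hτ, .inr ⟨x, f, ys, hs, θ, hθ, linkAliases_mono hR _ h⟩⟩

/-- The kill sets of anticipability refer to the aliases after the statement. As aliases are
never killed, these comprise the aliases before it. -/
theorem nonNull_stmtAnt {R R₁ : AP V F → AP V F → Prop} (hm : m.Valid) (hR : AliasSound m R)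
    (hac : m.Acyclic) (hac₁ : m₁.Acyclic) {s : Stmt V F Fn}
    (hflow : ∀ ρ ρ', P.aliasGen R s ρ ρ' → R₁ ρ ρ')
    (h : P.execStmt env k m s = some m₁) {X : Set (AP V F)} (hX : NonNull m₁ X) :
    NonNull m (P.stmtAnt R₁ s X) := by
  have hRR₁ : ∀ ρ ρ', R ρ ρ' → R₁ ρ ρ' := fun ρ ρ' hρ =>
    hflow ρ ρ' (.inl ⟨ρ, ρ', .same ρ, .same ρ', hρ⟩)
  rintro ρ ((⟨hρ, hk⟩ | hρ) | ⟨x, y, σ, rfl, hσ, rfl⟩)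
  · rw [← target_eq_of_notMem_kill hm hR h fun h' => hk (kill_mono hRR₁ s h')]
    exact hX ρ hρ
  · exact nonNull_anDirect h ρ hρ
  · rw [← assign_target hac hac₁ h]
    exact hX _ hσ

/-! ### Live links -/

/-- Membership in `X` only depends on the link that a path denotes. -/
def LinkClosed (m : Mem V F) (X : Set (AP V F)) : Prop :=
  ∀ ρ ∈ X, ∀ ρ' l, m.link ρ = some l → m.link ρ' = some l → ρ' ∈ X

theorem exists_link_lhs {s : Stmt V F Fn} (h : P.execStmt env k m s = some m₁) {x : AP V F}
    (hx : s.lhs = some x) : ∃ l, m.link x = some l := by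
  cases s with
  | assign x y =>
    cases hx
    obtain ⟨lx, hlx, h⟩ := Option.bind_eq_some_iff.1 h
    exact ⟨lx, hlx⟩
  | alloc x =>
    cases hx
    obtain ⟨lx, hlx, h⟩ := Option.map_eq_some_iff.1 h
    exact ⟨lx, hlx⟩
  | null x =>
    cases hx
    obtain ⟨lx, hlx, h⟩ := Option.map_eq_some_iff.1 h
    exact ⟨lx, hlx⟩
  | call x f ys =>
    cases hx
    obtain ⟨lx, hlx, h⟩ := execStmt_call_eq_some h
    exact ⟨lx, hlx⟩
  | _ => simp [Stmt.lhs] at hx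

theorem exists_target_of_link_snoc {ρ : AP V F} {f : F} {l : Link V F}
    (h : m.link (ρ.ext' [f]) = some l) : ∃ n, m.target ρ = some n ∧ l = .field n f := by
  rw [link_snoc] at h
  obtain ⟨n, hn, rfl⟩ := Option.map_eq_some_iff.1 h
  exact ⟨n, hn, rfl⟩

/-- A link that is live after a statement which does not change it was live before. Links of
objects that the statement creates are exempt, as no path denoted them before. -/
theorem mem_links_of_notMem_written (hm : m.Valid) (hac : m.Acyclic) (hac₁ : m₁.Acyclic)
    {s : Stmt V F Fn} (h : P.execStmt env k m s = some m₁) {X X₁ : Set (AP V F)}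
    (hX₁ : LinkClosed m₁ X₁) (hX : P.stmtLive s X₁ ⊆ X) {l : Link V F}
    (hl : l ∈ m₁.links X₁) (hW : l ∉ P.written m s) (hlm : l ∈ m.Allocated) :
    l ∈ m.links X := by
  obtain ⟨ρ, hρ, hl⟩ := hl
  rcases same_or_crosses (fun l => execStmt_val_eq (l := l) h) ρ with
    ⟨heq, -, hp⟩ | ⟨τ, σ, rfl, l', hl', hτ, hτ'⟩
  · refine ⟨ρ, hX (.inl (.inl ⟨hρ, ?_⟩)), heq ▸ hl⟩
    rintro ⟨x, hx, hρx⟩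
    obtain ⟨lx, hlx⟩ := exists_link_lhs h hx
    exact hp x hρx lx (.inl ⟨x, hx, hlx⟩) hlx
  · -- the path passes through a changed link `l'` before it comes to its last link
    have hσ : σ ≠ [] := by
      rintro rfl
      rw [AP.ext'_nil, hτ'] at hl
      exact hW (Option.some.inj hl ▸ hl')
    obtain ⟨σ, f, rfl⟩ := List.eq_nil_or_concat σ |>.resolve_left hσ
    rw [List.concat_eq_append] at hρ hl
    have hl₁ := hl
    rw [← AP.ext'_ext'] at hl₁
    obtain ⟨n, hn, rfl⟩ := exists_target_of_link_snoc hl₁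
    have hnτ : m₁.target τ ≠ none :=
      target_ne_none_of_mem_prefixes (by rw [hn]; simp) ⟨σ, rfl⟩
    rcases hl' with ⟨x, hx, hlx⟩ | ⟨x, g, ys, rfl, hl'⟩
    · cases s with
      | assign x y =>
        cases hx
        have hlx₁ : m₁.link x = some l' := by
          refine hac.link_eq_of_agree hlx fun l hl => execStmt_val_eq h ?_
          rintro (⟨x', hx', hl'⟩ | ⟨_, _, _, heq, -⟩)
          · cases hx'
            exact hl (Option.some.inj (hl'.symm.trans hlx))
          · cases heq
        -- by closure, `x` followed by the rest of the path is live, which is transferred to `y`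
        have ht : m₁.target (x.ext' σ) = some n := by
          rw [← hn]
          refine target_ext'_congr ?_ σ
          rw [target_eq_val hlx₁, target_eq_val hτ']
        have hx₁ : x.ext' (σ ++ [f]) ∈ X₁ := by
          refine hX₁ _ hρ _ _ hl ?_
          rw [← AP.ext'_ext', link_snoc, ht]; rfl
        refine ⟨y.ext' (σ ++ [f]), hX (.inr ⟨x, y, _, rfl, hx₁, rfl⟩), ?_⟩
        rw [← AP.ext'_ext', link_snoc, ← assign_target hac hac₁ h, ht]; rfl
      | alloc x =>
        cases hx
        obtain ⟨-, rfl⟩ := alloc_ext' hm h hlx hτ' hn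
        exact absurd (hlm _ f rfl) (lt_irrefl _)
      | null x =>
        cases hx
        obtain ⟨lx, hlx', rfl⟩ := Option.map_eq_some_iff.1 h
        obtain rfl := Option.some.inj (hlx.symm.trans hlx')
        rw [target_eq_val hτ', val_write_self] at hnτ
        exact absurd rfl hnτ
      | call x g ys =>
        cases hx
        -- behind a link written by the call there are only objects known to the callee
        obtain ⟨j, hj⟩ := Option.ne_none_iff_exists'.1 hnτ
        have hi := mem_inner_ext' h hj
          (mem_inner_of_val h (.inl hlx) ((target_eq_val hτ').symm.trans hj)) σ hn
        exact absurd (field_mem_written hi f) hW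
      | _ => simp [Stmt.lhs] at hx
    · obtain ⟨j, hj⟩ := Option.ne_none_iff_exists'.1 hnτ
      have hi := mem_inner_ext' h hj (mem_inner_of_val h
        (written_call (.inr ⟨x, g, ys, rfl, hl'⟩)) ((target_eq_val hτ').symm.trans hj)) σ hn
      exact absurd (field_mem_written hi f) hW

/-! ### Simulation of the original program by the modified one -/

variable {n n₁ : Mem V F} {X X₁ : Set (AP V F)} {S : Set (Link V F)} {s : Stmt V F Fn}

/-- The memory graph `n` of the modified program agrees with the memory graph `m` of the
original program in the links that the live paths `X` denote in `m`. -/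
structure Sim (X : Set (AP V F)) (m n : Mem V F) : Prop where
  left : m.Valid
  right : n.Valid
  next : n.next = m.next
  val : ∀ l ∈ m.links X, n.val l = m.val l

theorem Sim.link_eq (h : Sim X m n) {ρ : AP V F} (hρ : ρ.properPrefixes ⊆ X) :
    n.link ρ = m.link ρ := by
  induction ρ using AP.snocInduction with
  | root v => rfl
  | snoc ρ f ih =>
    rw [AP.properPrefixes_snoc] at hρ
    have hl := ih fun τ hτ => hρ (AP.properPrefixes_subset ρ hτ)
    have : n.target ρ = m.target ρ := by
      rw [target_eq_link_bind, target_eq_link_bind, hl]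
      cases hlρ : m.link ρ with
      | none => rfl
      | some l => exact h.val l ⟨ρ, hρ (AP.mem_prefixes_self ρ), hlρ⟩
    rw [link_snoc, link_snoc, this]

theorem Sim.target_eq (h : Sim X m n) {ρ : AP V F} (hp : ρ.properPrefixes ⊆ X) (hρ : ρ ∈ X) :
    n.target ρ = m.target ρ := by
  rw [target_eq_link_bind, target_eq_link_bind, h.link_eq hp]
  cases hl : m.link ρ with
  | none => rfl
  | some l => exact h.val l ⟨ρ, hρ, hl⟩

theorem Sim.target_eq' (h : Sim X m n) {ρ : AP V F} (hp : ρ.prefixes ⊆ X) :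
    n.target ρ = m.target ρ :=
  h.target_eq ((AP.properPrefixes_subset ρ).trans hp) (hp (AP.mem_prefixes_self ρ))

theorem Sim.links_eq (h : Sim X m n) {Y : Set (AP V F)}
    (hY : ∀ ρ ∈ Y, ρ.properPrefixes ⊆ X) : n.links Y = m.links Y := by
  ext l
  exact exists_congr fun ρ => and_congr_right fun hρ => by rw [h.link_eq (hY ρ hρ)]

theorem Sim.objects_eq (h : Sim X m n) {Y : Set (AP V F)}
    (hY : ∀ ρ ∈ Y, ρ.prefixes ⊆ X) : n.objects Y = m.objects Y := by
  ext l
  exact exists_congr fun ρ => and_congr_right fun hρ => by rw [h.target_eq' (hY ρ hρ)]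

theorem Sim.allocated_eq (h : Sim X m n) : n.Allocated = m.Allocated := by
  simp only [Allocated, h.next]

/-! ### The uses of a statement -/

theorem mem_prefixes_or {τ ρ υ : AP V F} (hτ : τ ∈ υ.prefixes) (hρ : ρ ∈ υ.prefixes) :
    τ ∈ ρ.prefixes ∨ ρ ∈ τ.prefixes := by
  obtain ⟨σ, rfl⟩ := hτ
  obtain ⟨σ', h⟩ := hρ
  have hr : τ.root = ρ.root := by injection h
  have hf : τ.fields ++ σ = ρ.fields ++ σ' := by injection h
  rcases List.prefix_or_prefix_of_prefix (List.prefix_append τ.fields σ)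
      (hf ▸ List.prefix_append ρ.fields σ') with ⟨υ, h⟩ | ⟨υ, h⟩
  · exact .inl ⟨υ, AP.ext hr.symm h.symm⟩
  · exact .inr ⟨υ, AP.ext hr h.symm⟩

theorem passed_prefixes_subset {x : AP V F} {f : Fn} {ys : List (AP V F)} {θ : AP V F}
    (hθ : θ ∈ P.passed ys) : θ.prefixes ⊆ P.uses (.call x f ys) := by
  intro τ hτ
  rcases hθ with hθ | ⟨y, hy, hθ⟩
  · obtain ⟨σ, rfl⟩ := hτ
    exact .inr (.inl hθ)
  · rcases mem_prefixes_or hτ (show y ∈ θ.prefixes from hθ) with h | h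
    · exact .inl (.inr ⟨y, hy, h⟩)
    · exact .inr (.inr ⟨y, hy, h⟩)

theorem exposed_subset_passed (ys : List (AP V F)) : P.exposed ys ⊆ P.passed ys := by
  rintro θ (hθ | ⟨y, hy, hθ⟩)
  · exact .inl hθ
  · exact .inr ⟨y, hy, AP.properPrefixes_subset _ hθ⟩

theorem prefixes_subset_uses {ρ : AP V F} (hρ : ρ ∈ P.uses s) : ρ.prefixes ⊆ P.uses s := by
  intro τ hτ
  cases s with
  | assign x y =>
    exact Or.imp (AP.properPrefixes_of_mem_prefixes hτ)
      (AP.properPrefixes_of_mem_prefixes hτ) hρ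
  | alloc x => exact AP.properPrefixes_of_mem_prefixes hτ hρ
  | null x => exact AP.properPrefixes_of_mem_prefixes hτ hρ
  | call x f ys =>
    rcases hρ with (hρ | ⟨y, hy, hρ⟩) | hρ
    · exact .inl (.inl (AP.properPrefixes_of_mem_prefixes hτ hρ))
    · exact .inl (.inr ⟨y, hy, AP.prefixes_trans hτ hρ⟩)
    · exact passed_prefixes_subset hρ hτ
  | use ys =>
    obtain ⟨y, hy, hρ⟩ := hρ
    exact ⟨y, hy, AP.prefixes_trans hτ hρ⟩
  | ret z =>
    rcases hρ with hρ | hρ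
    · exact .inl (AP.prefixes_trans hτ hρ)
    · exact mem_prefixes_or hτ (show z ∈ ρ.prefixes from hρ)
  | other => exact absurd hρ (Set.notMem_empty ρ)

theorem lhs_properPrefixes_subset_uses {x : AP V F} (hx : s.lhs = some x) :
    x.properPrefixes ⊆ P.uses s := by
  cases s with
  | assign x y => cases hx; exact Set.subset_union_left
  | alloc x => cases hx; exact subset_rfl
  | null x => cases hx; exact subset_rfl
  | call x f ys => cases hx; exact Set.subset_union_left.trans Set.subset_union_left
  | _ => simp [Stmt.lhs] at hx

theorem Sim.written_eq (h : Sim X m n) (hX : P.uses s ⊆ X) :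
    P.written n s = P.written m s := by
  ext l
  refine or_congr (exists_congr fun x => and_congr_right fun hx => ?_)
    (exists_congr fun x => exists_congr fun f => exists_congr fun ys =>
      and_congr_right fun hs => ?_)
  · rw [h.link_eq ((lhs_properPrefixes_subset_uses hx).trans hX)]
  · subst hs
    rw [h.allocated_eq, h.links_eq fun ρ hρ => ?_]
    exact (AP.properPrefixes_subset ρ).trans
      ((passed_prefixes_subset (exposed_subset_passed ys hρ)).trans hX)

/-! ### One step of the simulation -/

/-- A statement that is executed in the original program is executed in the modified program,
too, as the links it uses are live. A callee receives the same globals, objects and arguments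
in both, and therefore behaves in the same way. -/
theorem Sim.execStmt (h : Sim X m n) (hac : m.Acyclic) (hac₁ : m₁.Acyclic)
    (hex : P.execStmt env k m s = some m₁) (hX₁ : LinkClosed m₁ X₁)
    (hX : P.stmtLive s X₁ ⊆ X) : ∃ n₁, P.execStmt env k n s = some n₁ ∧ Sim X₁ m₁ n₁ := by
  have hU : P.uses s ⊆ X := fun ρ hρ => hX (.inl (.inr hρ))
  have hm₁ := execStmt_valid h.left hex
  have hlhs : ∀ {x}, s.lhs = some x → n.link x = m.link x := fun hx =>
    h.link_eq ((lhs_properPrefixes_subset_uses hx).trans hU)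
  -- only the links that the statement changes have to be compared
  have key : ∀ n₁, P.execStmt env k n s = some n₁ → n₁.next = m₁.next →
      (∀ l ∈ m₁.links X₁, l ∈ P.written m s → n₁.val l = m₁.val l) →
      ∃ n₁, P.execStmt env k n s = some n₁ ∧ Sim X₁ m₁ n₁ := by
    intro n₁ hn₁ hnext hval
    refine ⟨n₁, hn₁, hm₁, execStmt_valid h.right hn₁, hnext, fun l hl => ?_⟩
    by_cases hW : l ∈ P.written m s
    · exact hval l hl hW
    · rw [execStmt_val_eq hn₁ (by rwa [h.written_eq hU]), execStmt_val_eq hex hW]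
      by_cases ha : l ∈ m.Allocated
      · exact h.val l (mem_links_of_notMem_written h.left hac hac₁ hex hX₁ hX hl hW ha)
      · -- the links of objects that did not exist before hold null in both memory graphs
        have hnone : ∀ m' : Mem V F, m'.Valid → l ∉ m'.Allocated → m'.val l = none := by
          intro m' hm' hl'
          by_contra hne
          obtain ⟨i, hi⟩ := Option.ne_none_iff_exists'.1 hne
          refine hl' ?_
          rintro j f rfl
          exact (hm'.2 j f i hi).1
        rw [hnone m h.left ha, hnone n h.right (by rwa [h.allocated_eq])]
  cases s with
  | assign x y =>
    obtain ⟨lx, hlx, hex'⟩ := Option.bind_eq_some_iff.1 hex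
    obtain ⟨ly, hly, rfl⟩ := Option.map_eq_some_iff.1 hex'
    have hy : n.link y = m.link y := h.link_eq (Set.subset_union_right.trans hU)
    refine key (n.write lx (n.target y)) ?_ h.next fun l hl hW => ?_
    · simp only [Proc.execStmt]
      rw [hlhs rfl, hlx, hy, hly]
      rfl
    · rcases hW with ⟨x', hx', hl'⟩ | ⟨_, _, _, heq, -⟩
      · cases hx'
        obtain rfl := Option.some.inj (hlx.symm.trans hl')
        rw [val_write_self, val_write_self]
        obtain ⟨ρ, hρ, hl⟩ := hl
        have hx₁ := hac.link_eq_of_agree hlx fun l => val_write_of_ne m (m.target y)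
        have hxX : x ∈ X₁ := hX₁ ρ hρ x _ hl hx₁
        exact h.target_eq (Set.subset_union_right.trans hU)
          (hX (.inr ⟨x, y, [], rfl, by simpa using hxX, by simp⟩))
      · cases heq
  | alloc x =>
    obtain ⟨lx, hlx, rfl⟩ := Option.map_eq_some_iff.1 hex
    refine key { n.write lx (some n.next) with next := n.next + 1 } ?_
      (congrArg Nat.succ h.next) fun l hl hW => ?_
    · simp only [Proc.execStmt]
      rw [hlhs rfl, hlx]
      rfl
    · rcases hW with ⟨x', hx', hl'⟩ | ⟨_, _, _, heq, -⟩
      · cases hx'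
        obtain rfl := Option.some.inj (hlx.symm.trans hl')
        have : (n.write lx (some n.next)).val lx = (m.write lx (some m.next)).val lx := by
          rw [val_write_self, val_write_self, h.next]
        cases lx <;> exact this
      · cases heq
  | null x =>
    obtain ⟨lx, hlx, rfl⟩ := Option.map_eq_some_iff.1 hex
    refine key (n.write lx none) ?_ h.next fun l hl hW => ?_
    · simp only [Proc.execStmt]
      rw [hlhs rfl, hlx]
      rfl
    · rcases hW with ⟨x', hx', hl'⟩ | ⟨_, _, _, heq, -⟩
      · cases hx'
        obtain rfl := Option.some.inj (hlx.symm.trans hl')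
        rw [val_write_self, val_write_self]
      · cases heq
  | call x f ys =>
    have hR := h.objects_eq (Y := P.passed ys) fun ρ hρ =>
      (passed_prefixes_subset hρ).trans hU
    have hys : ∀ y ∈ ys, y.prefixes ⊆ X := fun y hy =>
      (passed_prefixes_subset (.inr ⟨y, hy, [], by simp⟩)).trans hU
    obtain ⟨lx, hlx, hy, m', v, hr, ha, rfl⟩ := execStmt_call_eq_some hex
    -- the callee cannot tell the two memory graphs apart
    have hview : P.view n (m.objects (P.passed ys)) = P.view m (m.objects (P.passed ys)) := by
      simp only [Proc.view, h.next, Mem.mk.injEq, and_true]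
      constructor
      · funext w
        split_ifs with hw
        · exact h.target_eq' ((passed_prefixes_subset (root_mem_passed ys hw)).trans hU)
        · rfl
      · funext j g
        split_ifs with hj
        · obtain ⟨θ, hθ, hj⟩ := hj
          refine h.val (.field j g) ⟨θ.ext' [g], ?_, by simp [hj]⟩
          exact hU (.inr (ext'_mem_passed hθ [g]))
        · rfl
    have hargs : ys.map n.target = ys.map m.target :=
      List.map_congr_left fun y hy => h.target_eq' (hys y hy)
    have hadm : P.Admissible n (m.objects (P.passed ys)) m' v := by
      simpa only [Proc.Admissible, h.next] using ha
    have hy' : ∀ y ∈ ys, n.link y ≠ none := fun y hy' => by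
      rw [h.link_eq ((AP.properPrefixes_subset y).trans (hys y hy'))]
      exact hy y hy'
    refine key ((P.overlay n (m.objects (P.passed ys)) m').write lx v) ?_ rfl
      fun l hl hW => ?_
    · simp only [Proc.execStmt]
      rw [hlhs rfl, hlx, hR, Option.bind_some, if_pos hy', hview, hargs, hr, Option.bind_some,
        if_pos hadm]
    · by_cases hl' : l = lx
      · subst hl'
        rw [val_write_self, val_write_self]
      · rw [val_write_of_ne _ _ hl', val_write_of_ne _ _ hl']
        rcases written_call hW with hl | ⟨w, hw, rfl⟩ | ⟨j, g, hj, rfl⟩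
        · exact absurd (Option.some.inj (hl.symm.trans hlx)) hl'
        · simp [Proc.overlay, hw]
        · have hj' : j ∈ m.objects (P.passed ys) ∨ m.next ≤ j := hj
          have hj'' : j ∈ m.objects (P.passed ys) ∨ n.next ≤ j := by rwa [h.next]
          exact (if_pos hj'').trans (if_pos hj').symm
  | use ys =>
    have hm := execStmt_eq_self rfl hex
    simp only [Proc.execStmt] at hex
    split_ifs at hex with hys
    refine key n ?_ (hm ▸ h.next) fun l hl hW => ?_
    · simp only [Proc.execStmt]
      rw [if_pos]
      intro y hy
      rw [h.target_eq' fun τ hτ => hU ⟨y, hy, hτ⟩]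
      exact hys y hy
    · rcases hW with ⟨x', hx', -⟩ | ⟨_, _, _, heq, -⟩
      · cases hx'
      · cases heq
  | ret z =>
    obtain ⟨lz, hlz, rfl⟩ := Option.map_eq_some_iff.1 hex
    refine key n ?_ h.next fun l hl hW => ?_
    · simp only [Proc.execStmt]
      rw [h.link_eq fun τ hτ => hU (.inl (AP.properPrefixes_subset z hτ)), hlz]
      rfl
    · rcases hW with ⟨x', hx', -⟩ | ⟨_, _, _, heq, -⟩
      · cases hx'
      · cases heq
  | other =>
    have hm := execStmt_eq_self rfl hex
    refine key n rfl (hm ▸ h.next) fun l hl hW => ?_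
    rcases hW with ⟨x', hx', -⟩ | ⟨_, _, _, heq, -⟩
    · cases hx'
    · cases heq

/-- The links in `S`, which hold the null reference under consideration, are allocated, and no
path in `X` denotes any of them. -/
structure Dead (X : Set (AP V F)) (m : Mem V F) (S : Set (Link V F)) : Prop where
  allocated : S ⊆ m.Allocated
  disjoint : Disjoint (m.links X) S

theorem Dead.carry (hS : Dead X m S) (h : Sim X m n) (hac : m.Acyclic) (hac₁ : m₁.Acyclic)
    (hex : P.execStmt env k m s = some m₁) (hX₁ : LinkClosed m₁ X₁)
    (hX : P.stmtLive s X₁ ⊆ X) : Dead X₁ m₁ (P.carry n S (.orig k s)) := by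
  have hU : P.uses s ⊆ X := fun ρ hρ => hX (.inl (.inr hρ))
  have hlhs : ∀ {x}, s.lhs = some x → n.link x = m.link x := fun hx =>
    h.link_eq ((lhs_properPrefixes_subset_uses hx).trans hU)
  have hmono : m.Allocated ⊆ m₁.Allocated := fun l hl j f hlj =>
    (hl j f hlj).trans_le (execStmt_next_le hex)
  have hdisj := Set.disjoint_left.1 hS.disjoint
  -- apart from the target of a copy, `carry` keeps links of `S` that the statement leaves alone
  have key : (∀ l ∈ P.carry n S (.orig k s), (l ∈ S ∧ l ∉ P.written m s) ∨
      (l ∈ m₁.Allocated ∧ l ∉ m₁.links X₁)) → Dead X₁ m₁ (P.carry n S (.orig k s)) := by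
    intro hc
    constructor
    · intro l hl
      exact (hc l hl).elim (fun h => hmono (hS.allocated h.1)) And.left
    · rw [Set.disjoint_right]
      intro l hl hlX
      rcases hc l hl with ⟨hlS, hW⟩ | ⟨-, hl⟩
      · exact hdisj (mem_links_of_notMem_written h.left hac hac₁ hex hX₁ hX hlX hW
          (hS.allocated hlS)) hlS
      · exact hl hlX
  refine key fun l hl => ?_
  cases s with
  | assign x y =>
    have hx : n.link x = m.link x := hlhs rfl
    rcases hl with ⟨hne, hl⟩ | ⟨hl, l', hl', hy⟩
    · refine .inl ⟨hl, ?_⟩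
      rintro (⟨x', hx', hl'⟩ | ⟨_, _, _, heq, -⟩)
      · cases hx'
        exact hne (hx.trans hl')
      · cases heq
    · rw [hx] at hl
      refine .inr ⟨hmono (h.left.link_mem_allocated hl), ?_⟩
      rintro ⟨ρ, hρ, hlρ⟩
      have hx₁ : m₁.link x = some l := by
        refine hac.link_eq_of_agree hl fun l hl' => execStmt_val_eq hex ?_
        rintro (⟨x', hx', hl''⟩ | ⟨_, _, _, heq, -⟩)
        · cases hx'
          exact hl' (Option.some.inj (hl''.symm.trans hl))
        · cases heq
      have hxX := hX₁ ρ hρ x l hlρ hx₁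
      refine hdisj ⟨y, hX (.inr ⟨x, y, [], rfl, by simpa using hxX, by simp⟩), ?_⟩ hl'
      rwa [← h.link_eq (Set.subset_union_right.trans hU)]
  | alloc x =>
    refine .inl ⟨hl.1, ?_⟩
    rintro (⟨x', hx', hl'⟩ | ⟨_, _, _, heq, -⟩)
    · cases hx'
      exact hl.2 ((hlhs rfl).trans hl')
    · cases heq
  | null x =>
    refine .inl ⟨hl.1, ?_⟩
    rintro (⟨x', hx', hl'⟩ | ⟨_, _, _, heq, -⟩)
    · cases hx'
      exact hl.2 ((hlhs rfl).trans hl')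
    · cases heq
  | call x f ys =>
    obtain ⟨hlS, hne, hle⟩ := hl
    refine .inl ⟨hlS, ?_⟩
    rintro (⟨x', hx', hl'⟩ | ⟨x', f', ys', heq, hl'⟩)
    · cases hx'
      exact hne ((hlhs rfl).trans hl')
    · cases heq
      rw [h.links_eq fun ρ hρ => (AP.properPrefixes_subset ρ).trans
        ((passed_prefixes_subset (exposed_subset_passed ys hρ)).trans hU)] at hle
      exact hl'.elim hle fun h => h (hS.allocated hlS)
  | _ =>
    refine .inl ⟨hl, ?_⟩
    rintro (⟨x', hx', -⟩ | ⟨_, _, _, heq, -⟩)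
    · cases hx'
    · cases heq

/-! ### Sequences of steps -/

/-- `P.Sched env as X m`: the steps `as` of the modified program are admissible where the paths
in `X` are live and `m` is the memory graph of the original program, which skips the inserted
assignments. A path that is set to null denotes a link in `m`, which no live path denotes,
and all its proper prefixes are live. -/
def Proc.Sched (P : Proc V F N Fn) (env : Env V F Fn) :
    List (Step V F Fn) → Set (AP V F) → Mem V F → Prop
  | [], _, _ => True
  | .orig k s :: as, X, m => ∃ X₁ m₁, P.execStmt env k m s = some m₁ ∧ m.Acyclic ∧
      m₁.Acyclic ∧ LinkClosed m₁ X₁ ∧ P.stmtLive s X₁ ⊆ X ∧ P.Sched env as X₁ m₁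
  | .inserted ρ :: as, X, m => ∃ X₁ ⊆ X, LinkClosed m X₁ ∧ ρ ∉ X₁ ∧ ρ.properPrefixes ⊆ X₁ ∧
      m.link ρ ≠ none ∧ P.Sched env as X₁ m
  | .finish :: as, X, m => P.outer ⊆ X ∧ P.Sched env as X m

theorem Proc.Sched.mono {as : List (Step V F Fn)} (h : P.Sched env as X m) (hX : X ⊆ X₁) :
    P.Sched env as X₁ m := by
  induction as with
  | nil => trivial
  | cons a as ih =>
    cases a with
    | orig k s =>
      obtain ⟨X₂, m₂, hex, hac, hac₂, hcl, hlive, h⟩ := h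
      exact ⟨X₂, m₂, hex, hac, hac₂, hcl, hlive.trans hX, h⟩
    | inserted ρ =>
      obtain ⟨X₂, hX₂, h⟩ := h
      exact ⟨X₂, hX₂.trans hX, h⟩
    | finish => exact ⟨h.1.trans hX, ih h.2⟩

theorem links_mono (m : Mem V F) (hX : X₁ ⊆ X) : m.links X₁ ⊆ m.links X := by
  rintro l ⟨ρ, hρ, hl⟩
  exact ⟨ρ, hX hρ, hl⟩

theorem Sim.mono (h : Sim X m n) (hX : X₁ ⊆ X) : Sim X₁ m n :=
  ⟨h.left, h.right, h.next, fun l hl => h.val l (links_mono m hX hl)⟩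

theorem Dead.mono (h : Dead X m S) (hX : X₁ ⊆ X) : Dead X₁ m S :=
  ⟨h.allocated, h.disjoint.mono_left (links_mono m hX)⟩

/-- An inserted assignment is executed without exception in the modified program. The link
that it nullifies is not denoted by a live path, so the live links keep their contents. -/
theorem exec_inserted {as : List (Step V F Fn)} {ρ : AP V F}
    (h : P.Sched env (.inserted ρ :: as) X m) (hs : Sim X m n) :
    ∃ n₁, P.exec env n (.inserted ρ) = some n₁ ∧ ∃ X₁ ⊆ X, P.Sched env as X₁ m ∧
      Sim X₁ m n₁ ∧ ρ.properPrefixes ⊆ X₁ ∧ Dead X₁ m {l | n.link ρ = some l} := by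
  obtain ⟨X₁, hX, hcl, hρ, hp, hl, h⟩ := h
  have hs₁ := hs.mono hX
  obtain ⟨l, hl⟩ := Option.ne_none_iff_exists'.1 hl
  have hn : n.link ρ = some l := (hs₁.link_eq hp).trans hl
  have hdead : Disjoint (m.links X₁) {l | n.link ρ = some l} := by
    rw [Set.disjoint_right]
    rintro l' hl' ⟨τ, hτ, hlτ⟩
    obtain rfl := Option.some.inj (hn.symm.trans hl')
    exact hρ (hcl τ hτ ρ _ hlτ hl)
  have hex : P.execStmt env 0 n (.null ρ) = some (n.write l none) := by
    simp only [Proc.execStmt, hn, Option.map_some]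
  refine ⟨n.write l none, hex, X₁, hX, h, ⟨hs.left, execStmt_valid hs.right hex, hs.next, fun l' hl' => ?_⟩,
    hp, fun l' hl' => ?_, hdead⟩
  · rw [val_write_of_ne, hs₁.val l' hl']
    rintro rfl
    exact Set.disjoint_left.1 hdead hl' hn
  · rw [← hs.allocated_eq]
    exact hs.right.link_mem_allocated hl'

/-- One step of the modified program: it uses none of the links in `S`, and raises no
exception. -/
theorem exec_step {a : Step V F Fn} {as : List (Step V F Fn)} (h : P.Sched env (a :: as) X m)
    (hs : Sim X m n) (hS : Dead X m S) :
    Disjoint (n.links (P.stepUses a)) S ∧ ∃ n₁, P.exec env n a = some n₁ ∧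
      ∃ X₁ m₁, P.Sched env as X₁ m₁ ∧ Sim X₁ m₁ n₁ ∧ Dead X₁ m₁ (P.carry n S a) := by
  have key : ∀ Y : Set (AP V F), (∀ ρ ∈ Y, ρ.prefixes ⊆ Y) → Y ⊆ X →
      Disjoint (n.links Y) S := by
    intro Y hY hYX
    rw [hs.links_eq fun ρ hρ => ((AP.properPrefixes_subset ρ).trans (hY ρ hρ)).trans hYX]
    exact hS.disjoint.mono_left (links_mono m hYX)
  cases a with
  | orig k s =>
    obtain ⟨X₁, m₁, hex, hac, hac₁, hcl, hlive, h⟩ := h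
    obtain ⟨n₁, hn₁, hs₁⟩ := hs.execStmt hac hac₁ hex hcl hlive
    exact ⟨key _ (fun _ => prefixes_subset_uses) fun ρ hρ => hlive (.inl (.inr hρ)),
      n₁, hn₁, X₁, m₁, h, hs₁, hS.carry hs hac hac₁ hex hcl hlive⟩
  | inserted ρ =>
    obtain ⟨n₁, hn₁, X₁, hX, h, hs₁, hp, -⟩ := exec_inserted h hs
    have hS₁ := hS.mono hX
    refine ⟨key _ (fun τ hτ υ hυ => AP.properPrefixes_of_mem_prefixes hυ hτ) (hp.trans hX),
      n₁, hn₁, X₁, m, h, hs₁, fun l hl => hS₁.allocated hl.1, hS₁.disjoint.mono_right ?_⟩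
    exact fun l hl => hl.1
  | finish =>
    refine ⟨key _ ?_ h.1, n, rfl, X, m, h.2, hs, hS⟩
    rintro ρ hρ τ ⟨σ, rfl⟩
    exact hρ

/-- Executing the steps `as` of an admissible sequence `as ++ bs` leads to a state from which
`bs` is admissible. -/
theorem run_sched {as bs : List (Step V F Fn)} (h : P.Sched env (as ++ bs) X m)
    (hs : Sim X m n) (hS : Dead X m S) :
    ∃ n₁, P.run env as n = some n₁ ∧ ∃ X₁ m₁, P.Sched env bs X₁ m₁ ∧ Sim X₁ m₁ n₁ ∧
      Dead X₁ m₁ (P.track env as n S) := by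
  induction as generalizing X m n S with
  | nil => exact ⟨n, rfl, X, m, h, hs, hS⟩
  | cons a as ih =>
    obtain ⟨-, n₁, hn₁, X₁, m₁, h₁, hs₁, hS₁⟩ := exec_step h hs hS
    obtain ⟨n₂, hn₂, X₂, m₂, h₂, hs₂, hS₂⟩ := ih h₁ hs₁ hS₁
    have htrack : P.track env (a :: as) n S = P.track env as n₁ (P.carry n S a) := by
      ext l
      refine ⟨fun ⟨n', hn', hl⟩ => ?_, fun hl => ⟨n₁, hn₁, hl⟩⟩
      rwa [Option.some.inj (hn₁.symm.trans hn')]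
    exact ⟨n₂, by simp only [Proc.run, hn₁, Option.bind_some, hn₂], X₂, m₂, h₂, hs₂,
      htrack ▸ hS₂⟩

/-! ### The steps along a control flow path -/

/-- `P.steps`, with the positions counted from `k`. -/
def Proc.stepsFrom (P : Proc V F N Fn) (ins : Point N → List (AP V F)) (π : List N) (k : ℕ) :
    List (Step V F Fn) :=
  ((π.zipIdx k).flatMap fun ik =>
    (ins (.before ik.1)).map .inserted ++ [.orig ik.2 (P.stmt ik.1)] ++
      (ins (.after ik.1)).map .inserted) ++ [.finish]

theorem stepsFrom_cons (ins : Point N → List (AP V F)) (i : N) (π : List N) (k : ℕ) :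
    P.stepsFrom ins (i :: π) k = (ins (.before i)).map .inserted ++
      .orig k (P.stmt i) :: ((ins (.after i)).map .inserted ++ P.stepsFrom ins π (k + 1)) := by
  simp [Proc.stepsFrom, List.zipIdx_cons]

variable {A : Point N → AP V F → AP V F → Prop} {L Av An : Point N → Set (AP V F)}

theorem sched_inserted {p : Point N} {ρs : List (AP V F)}
    (hρs : ∀ ρ ∈ ρs, P.Nullify A L Av An ρ p) (hL : LinkClosed m (L p))
    (hAv : NonNull m (Av p)) (hAn : NonNull m (An p)) {as : List (Step V F Fn)}
    (h : P.Sched env as (L p) m) : P.Sched env (ρs.map .inserted ++ as) (L p) m := by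
  induction ρs with
  | nil => exact h
  | cons ρ ρs ih =>
    obtain ⟨⟨hρ, hbase⟩, hp, -⟩ := hρs ρ (by simp)
    refine ⟨L p, subset_rfl, hL, hρ, hp, ?_, ih fun τ hτ => hρs τ (by simp [hτ])⟩
    induction ρ using AP.snocInduction with
    | root v => simp
    | snoc ρ f _ =>
      rw [AP.base_snoc] at hbase
      have ht : m.target ρ ≠ none := by
        rcases hbase with h | h | h
        · simp [AP.Simple, AP.ext'] at h
        · exact hAv ρ h
        · exact hAn ρ h
      simpa using ht

theorem AliasSound.linkClosed (hL : IsLiveInfo P A L) {p : Point N}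
    (h : AliasSound m (A p)) : LinkClosed m (L p) :=
  fun ρ hρ _ _ hl hl' => hL.closed p ρ hρ (h.mem_linkAliases hl hl')

/-- Availability, aliases and acyclicity are carried forward over the node `i`; liveness and
anticipability are carried back over it from the rest `π` of the path. -/
theorem sched_stepsFrom_cons (hA : IsAliasInfo P A) (hL : IsLiveInfo P A L)
    (hAv : IsAvailInfo P A Av) (hAn : IsAntInfo P A An) {ins : Point N → List (AP V F)}
    (hins : ∀ p, ∀ ρ ∈ ins p, P.Nullify A L Av An ρ p) {i : N} {π : List N}
    (hrest : ∀ m₁ : Mem V F, m₁.Valid → AliasSound m₁ (A (.after i)) →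
      NonNull m₁ (Av (.after i)) → P.run env (P.stepsFrom (fun _ => []) π (k + 1)) m₁ ≠ none →
      (∀ as, as <+: P.stepsFrom (fun _ => []) π (k + 1) →
        ∀ m', P.run env as m₁ = some m' → m'.Acyclic) →
      P.Sched env (P.stepsFrom ins π (k + 1)) (L (.after i)) m₁ ∧ NonNull m₁ (An (.after i)))
    (hm : m.Valid) (halias : AliasSound m (A (.before i))) (hav : NonNull m (Av (.before i)))
    (hrun : P.run env (P.stepsFrom (fun _ => []) (i :: π) k) m ≠ none)
    (hacyclic : ∀ as, as <+: P.stepsFrom (fun _ => []) (i :: π) k →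
      ∀ m', P.run env as m = some m' → m'.Acyclic) :
    P.Sched env (P.stepsFrom ins (i :: π) k) (L (.before i)) m ∧ NonNull m (An (.before i)) := by
  simp only [stepsFrom_cons, List.map_nil, List.nil_append] at hrun hacyclic
  obtain ⟨m₁, hex⟩ : ∃ m₁, P.execStmt env k m (P.stmt i) = some m₁ := by
    rw [← Option.ne_none_iff_exists']
    intro h
    exact hrun (by simp [Proc.run, Proc.exec, h])
  have hcons : ∀ as, P.run env (.orig k (P.stmt i) :: as) m = P.run env as m₁ := fun as => by
    simp [Proc.run, Proc.exec, hex]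
  have hac : m.Acyclic := hacyclic [] (List.nil_prefix) m rfl
  have htail : ∀ as, as <+: P.stepsFrom (fun _ => []) π (k + 1) →
      ∀ m', P.run env as m₁ = some m' → m'.Acyclic := fun as has m' hm' =>
    hacyclic (.orig k (P.stmt i) :: as) (List.cons_prefix_cons.2 ⟨rfl, has⟩) m'
      ((hcons as).trans hm')
  have hac₁ : m₁.Acyclic := htail [] (List.nil_prefix) m₁ rfl
  have halias₁ : AliasSound m₁ (A (.after i)) :=
    aliasSound_after hm halias (hA.refl _) hac₁ (hA.flow i) hex
  have hav₁ : NonNull m₁ (Av (.after i)) := fun ρ hρ =>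
    nonNull_stmtAvail hm halias hac hac₁ hex hav ρ (hAv.flow i hρ)
  obtain ⟨hsched, han₁⟩ :=
    hrest m₁ (execStmt_valid hm hex) halias₁ hav₁ (hcons _ ▸ hrun) htail
  have han : NonNull m (An (.before i)) := fun ρ hρ =>
    nonNull_stmtAnt hm halias hac hac₁ (hA.flow i) hex han₁ ρ (hAn.flow i hρ)
  have hcl₁ := halias₁.linkClosed hL
  refine ⟨?_, han⟩
  rw [stepsFrom_cons]
  refine sched_inserted (hins _) (halias.linkClosed hL) hav han ?_
  exact ⟨L (.after i), m₁, hex, hac, hac₁, hcl₁, hL.flow i,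
    sched_inserted (hins _) hcl₁ hav₁ han₁ hsched⟩

theorem sched_stepsFrom (hA : IsAliasInfo P A) (hL : IsLiveInfo P A L)
    (hAv : IsAvailInfo P A Av) (hAn : IsAntInfo P A An) {ins : Point N → List (AP V F)}
    (hins : ∀ p, ∀ ρ ∈ ins p, P.Nullify A L Av An ρ p) {i : N} {π : List N}
    (hchain : (i :: π).IsChain P.edge) (hlast : (i :: π).getLast? = some P.exit)
    (hm : m.Valid) (halias : AliasSound m (A (.before i))) (hav : NonNull m (Av (.before i)))
    (hrun : P.run env (P.stepsFrom (fun _ => []) (i :: π) k) m ≠ none)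
    (hacyclic : ∀ as, as <+: P.stepsFrom (fun _ => []) (i :: π) k →
      ∀ m', P.run env as m = some m' → m'.Acyclic) :
    P.Sched env (P.stepsFrom ins (i :: π) k) (L (.before i)) m ∧ NonNull m (An (.before i)) := by
  induction π generalizing i k m with
  | nil =>
    obtain rfl : i = P.exit := by simpa using hlast
    refine sched_stepsFrom_cons hA hL hAv hAn hins (fun m₁ _ _ _ _ _ => ⟨?_, ?_⟩) hm halias hav
      hrun hacyclic
    · exact ⟨hL.exit, trivial⟩
    · simp [hAn.exit, NonNull]
  | cons j π ih =>
    obtain ⟨hij, hchain⟩ := List.isChain_cons_cons.1 hchain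
    rw [List.getLast?_cons_cons] at hlast
    refine sched_stepsFrom_cons hA hL hAv hAn hins (fun m₁ hm₁ halias₁ hav₁ hrun₁ hac₁ => ?_) hm
      halias hav hrun hacyclic
    obtain ⟨h, han⟩ := ih hchain hlast hm₁
      (fun ρ ρ' n hρ hρ' => hA.merge i j hij ρ ρ' (halias₁ ρ ρ' n hρ hρ'))
      (fun ρ hρ => hav₁ ρ (hAv.merge i j hij hρ)) hrun₁ hac₁
    exact ⟨h.mono (hL.merge i j hij), fun ρ hρ => han ρ (hAn.merge i j hij hρ)⟩

end HRA

open HRA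
theorem mainTheorem1 {V F N Fn : Type*} (P : Proc V F N Fn)
    -- the results of the analyses of the original program
    (A : Point N → AP V F → AP V F → Prop) (L Av An : Point N → Set (AP V F))
    (hA : IsAliasInfo P A) (hL : IsLiveInfo P A L)
    (hAv : IsAvailInfo P A Av) (hAn : IsAntInfo P A An)
    -- the null assignments inserted at each point, in the order of their execution
    (ins : Point N → List (AP V F))
    (hins : ∀ p, ∀ ρ ∈ ins p, P.Nullify A L Av An ρ p)
    -- an execution path along which the original program raises no exception, with acyclic heaps
    (env : Env V F Fn) (π : List N) (hπ : P.IsPath π) (m₀ : Mem V F) (hm₀ : P.IsInitial m₀)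
    (hrun : P.run env (P.steps (fun _ => []) π) m₀ ≠ none)
    (hacyclic : ∀ as, as <+: P.steps (fun _ => []) π →
      ∀ m, P.run env as m₀ = some m → m.Acyclic) :
    -- the execution of the modified program reaches each inserted assignment `ρ = null`
    ∀ pre ρ post, P.steps ins π = pre ++ Step.inserted ρ :: post →
      ∃ m, P.run env pre m₀ = some m ∧
        -- and executes it without a dereferencing exception,
        ∃ m', P.exec env m (.inserted ρ) = some m' ∧
          -- and it reaches each later step, and no link used there has been nullified by it
          ∀ mid a rest, post = mid ++ a :: rest →
            ∃ ma, P.run env mid m' = some ma ∧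
              Disjoint (ma.links (P.stepUses a))
                (P.track env mid m' {l | m.link ρ = some l}) := by
  intro pre ρ post hsteps
  obtain ⟨hhead, hlast, hchain⟩ := hπ
  obtain ⟨i, π, rfl⟩ : ∃ i π', π = i :: π' := by
    cases π with
    | nil => simp at hhead
    | cons i π => exact ⟨i, π, rfl⟩
  obtain rfl : i = P.entry := by simpa using hhead
  -- as locals are null at the entry, only paths rooted at globals or parameters lead to objects
  have houter : ∀ τ n, m₀.target τ = some n → τ ∈ P.outer := by
    intro τ n hn
    by_contra hτ
    have hτ' : ¬ (τ.root ∈ P.globals ∨ τ.root ∈ P.params) := hτ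
    rw [not_or] at hτ'
    have hroot := Mem.target_ne_none_of_mem_prefixes (m := m₀) (ρ := τ) (τ := ⟨τ.root, []⟩)
      (by rw [hn]; simp) ⟨τ.fields, by simp [AP.ext']⟩
    exact hroot (hm₀.2 _ hτ'.1 hτ'.2)
  obtain ⟨hsched, -⟩ := sched_stepsFrom (k := 0) hA hL hAv hAn hins hchain hlast hm₀.1
    (fun τ τ' n h h' => hA.entry τ (houter τ n h) τ' (houter τ' n h'))
    (by simp [hAv.entry, NonNull]) hrun hacyclic
  have hsched' : P.Sched env (pre ++ Step.inserted ρ :: post) (L (.before P.entry)) m₀ :=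
    hsteps ▸ hsched
  obtain ⟨m, hm, X, mo, h, hs, -⟩ := run_sched hsched'
    ⟨hm₀.1, hm₀.1, rfl, fun _ _ => rfl⟩ (S := ∅) ⟨Set.empty_subset _, by simp⟩
  obtain ⟨m', hm', X', -, h', hs', -, hS⟩ := exec_inserted h hs
  refine ⟨m, hm, m', hm', ?_⟩
  rintro mid a rest rfl
  obtain ⟨ma, hma, X'', mo', h'', hs'', hS'⟩ := run_sched h' hs' hS
  exact ⟨ma, hma, (exec_step h'' hs'' hS').1⟩
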